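/- Let $k\ge 1$ and $d\ge 2$ be integers, and let $\Gamma^d=(V,L)$ be the Cayley tree of order $d$, i.e. the infinite tree in which every vertex has exactly $d+1$ neighbours. Let $Q:\mathbb{Z}^k\to(0,\infty)$ be a strictly positive symmetric function ($Q(-j)=Q(j)$) with $Q(0)=1$. It defines on $\Omega=(\mathbb{Z}^k)^V$ (with the product $\sigma$-algebra) the nearest-neighbour gradient specification $$\gamma_\Lambda(\sigma_\Lambda=\omega_\Lambda\mid\omega)=Z_\Lambda(\omega_{\partial\Lambda})^{-1}\prod_{\{x,y\}\in L,\ \{x,y\}\cap\Lambda\ne\emptyset}Q(\omega_x-\omega_y),\qquad \Lambda\subset V\text{ finite},$$ where $Z_\Lambda(\omega_{\partial\Lambda})$ is the normalizing constant. A Gibbs measure is a probability measure $\mu$ on $\Omega$ with $\int\gamma_\Lambda(A\mid\omega)\,\mu(d\omega)=\mu(A)$ for all finite $\Lambda\subset V$ and all measurable $A$, the specification being well defined, i.e. $0<Z_\Lambda(\omega_{\partial\Lambda})<\infty$ for all finite $\Lambda$ and all $\omega$. For $p\ge 1$ and $S\subset\mathbb{Z}^k$ write $\Vert Q\Vert_{p,S}=\big(\sum_{j\in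 S}|Q(j)|^p\big)^{1/p}$, and define $$G_d=\Big\{(\gamma,\delta)\in(1,\infty)\times(0,\infty)\ \Big|\ \exists\,\varepsilon>0:\ \delta+\gamma\varepsilon^d\le\varepsilon\ \text{ and }\ 2d\gamma\varepsilon^{d-1}+2d\delta\varepsilon^d<1\Big\}.$$ Set $\gamma=\Vert Q\Vert_{\frac{d+1}{2},\mathbb{Z}^k}$ and $\delta=\Vert Q\Vert_{d+1,\mathbb{Z}^k\setminus\{0\}}$. Suppose that $(\gamma,\delta)\in G_d$ (in particular both norms are finite). Then there is a family $(\mu_i)_{i\in\mathbb{Z}^k}$ of pairwise distinct Gibbs measures for $Q$, each invariant under all automorphisms of the tree, which are translates of one another: for all $i,j\in\mathbb{Z}^k$, $\mu_{i+j}$ is the image of $\mu_i$ under $(\omega_x)_{x\in V}\mapsto(\omega_x+j)_{x\in V}$. Moreover, the equation $\varepsilon=\gamma\varepsilon^d+\delta$ has a smallest positive solution $\varepsilon=\varepsilon(\gamma,\delta)$, it satisfies $1-\gamma\varepsilon^{d-1}>0$, and for every $i\in\mathbb{Z}^k$ and every vertex $x\in V$ one has $\mu_i(\sigma_x=i)>0$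 and $$\left(\delta\,\frac{1-\delta\varepsilon^d}{1+\gamma\varepsilon^{d-1}}\right)^{d+1}\le\frac{\mu_i(\sigma_x\neq i)}{\mu_i(\sigma_x=i)}\le\left(\delta\,\frac{1+\delta\varepsilon^d}{1-\gamma\varepsilon^{d-1}}\right)^{d+1}.$$ -/

import Mathlib

open MeasureTheory
open scoped ENNReal

noncomputable section

namespace TreeGibbs

/-- The local state space, the integer lattice of dimension `k`. -/
abbrev Lattice (k : ℕ) : Type := Fin k → ℤ

/-- Configurations on the vertex set `V`, with the product sigma-algebra. -/
abbrev Config (V : Type*) (k : ℕ) : Type _ := V → Lattice k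

/-- A strictly positive symmetric gradient transfer operator: the edge `{x, y}` carries the
weight `Q (ω x - ω y)`, and symmetry makes this independent of the orientation of the edge. -/
structure TransferOperator (k : ℕ) where
  toFun : Lattice k → ℝ
  pos : ∀ j, 0 < toFun j
  symm : ∀ j, toFun (-j) = toFun j

instance (k : ℕ) : CoeFun (TransferOperator k) (fun _ => Lattice k → ℝ) :=
  ⟨TransferOperator.toFun⟩

/-- The `p`-norm of `x` over the set `S`, with value `∞` if the series diverges. -/
def pNorm {k : ℕ} (p : ℝ) (S : Set (Lattice k)) (x : Lattice k → ℝ) : ℝ≥0∞ :=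
  (∑' j : S, ENNReal.ofReal (|x j| ^ p)) ^ (1 / p)

/-- The good set of pairs `(γ, δ)`. -/
def goodSet (d : ℕ) : Set (ℝ × ℝ) :=
  {q | 1 < q.1 ∧ 0 < q.2 ∧ ∃ ε : ℝ, 0 < ε ∧ q.2 + q.1 * ε ^ d ≤ ε ∧
    2 * d * q.1 * ε ^ (d - 1) + 2 * d * q.2 * ε ^ d < 1}

variable {V : Type*} {k : ℕ}

/-- The weight of the unoriented edge `b` in the configuration `ω`. -/
def edgeWeight (Q : TransferOperator k) (ω : Config V k) : Sym2 V → ℝ :=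
  Sym2.lift ⟨fun x y => Q (ω x - ω y), fun x y => by
    show Q (ω x - ω y) = Q (ω y - ω x)
    rw [← Q.symm, neg_sub]⟩

open Classical in
/-- The finite set of edges of `G` that meet the finite volume `Λ`. -/
def touchingEdges (G : SimpleGraph V) [G.LocallyFinite] (Λ : Finset V) : Finset (Sym2 V) :=
  Λ.biUnion fun x => G.incidenceFinset x

theorem mem_touchingEdges (G : SimpleGraph V) [G.LocallyFinite] (Λ : Finset V) (b : Sym2 V) :
    b ∈ touchingEdges G Λ ↔ b ∈ G.edgeSet ∧ ∃ x ∈ Λ, x ∈ b := by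
  classical
  simp only [touchingEdges, Finset.mem_biUnion, SimpleGraph.mem_incidenceFinset,
    SimpleGraph.incidenceSet, Set.mem_ofPred_eq]
  tauto

/-- The product of the edge weights over all edges that meet `Λ`. -/
def volumeWeight (G : SimpleGraph V) [G.LocallyFinite] (Q : TransferOperator k)
    (Λ : Finset V) (ω : Config V k) : ℝ≥0∞ :=
  ∏ b ∈ touchingEdges G Λ, ENNReal.ofReal (edgeWeight Q ω b)

open Classical in
/-- The configuration equal to `ζ` inside `Λ` and to `ω` outside. -/
def glue (Λ : Finset V) (ζ : Λ → Lattice k) (ω : Config V k) : Config V k :=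
  fun x => if h : x ∈ Λ then ζ ⟨x, h⟩ else ω x

/-- The partition function in the volume `Λ` with boundary condition `ω`. -/
def partitionFunction (G : SimpleGraph V) [G.LocallyFinite] (Q : TransferOperator k)
    (Λ : Finset V) (ω : Config V k) : ℝ≥0∞ :=
  ∑' ζ : Λ → Lattice k, volumeWeight G Q Λ (glue Λ ζ ω)

/-- The kernel of the Gibbsian specification in the volume `Λ`: the spins outside `Λ` are those
of `ω`, and the spins inside `Λ` equal `ζ` with probability proportional to the weight of the
glued configuration. -/
def gibbsKernel (G : SimpleGraph V) [G.LocallyFinite] (Q : TransferOperator k)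
    (Λ : Finset V) (ω : Config V k) : Measure (Config V k) :=
  (partitionFunction G Q Λ ω)⁻¹ • Measure.sum fun ζ : Λ → Lattice k =>
    volumeWeight G Q Λ (glue Λ ζ ω) • Measure.dirac (glue Λ ζ ω)

/-- `μ` is a Gibbs measure: the specification is well defined (all partition functions are
positive and finite), and the probability measure `μ` satisfies the DLR equations
in all finite volumes. -/
structure IsGibbsMeasure (G : SimpleGraph V) [G.LocallyFinite] (Q : TransferOperator k)
    (μ : Measure (Config V k)) : Prop where
  wellDefined : ∀ (Λ : Finset V) (ω : Config V k),
    0 < partitionFunction G Q Λ ω ∧ partitionFunction G Q Λ ω < ∞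
  isProbabilityMeasure : IsProbabilityMeasure μ
  dlr : ∀ (Λ : Finset V) (A : Set (Config V k)), MeasurableSet A →
    ∫⁻ ω, gibbsKernel G Q Λ ω A ∂μ = μ A

/-- Invariance under all automorphisms of the graph. -/
def IsAutInvariant (G : SimpleGraph V) (μ : Measure (Config V k)) : Prop :=
  ∀ φ : G ≃g G, μ.map (fun ω x => ω (φ x)) = μ

end TreeGibbs

end

noncomputable section

namespace TreeGibbs

section

variable {V : Type*} {k : ℕ}

/-- In a tree with root `o`, every vertex other than `o` has a parent. -/
theorem exists_parent {G : SimpleGraph V} (hG : G.IsTree) (o : V) :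
    ∃ par : V → V,
      (∀ v, v ≠ o → G.Adj v (par v) ∧ G.dist o v = G.dist o (par v) + 1) ∧
      (∀ u v, G.Adj u v → (v ≠ o ∧ u = par v) ∨ (u ≠ o ∧ v = par u)) ∧
      ∀ Δ : Finset V, o ∈ Δ → (G.induce (Δ : Set V)).Connected → ∀ v ∈ Δ, v ≠ o → par v ∈ Δ := by
  classical
  choose p hp hlen using fun v => hG.connected.exists_path_of_dist v o
  have huniq : ∀ v (q : G.Walk v o), q.IsPath → q = p v := fun v q hq =>
    congrArg Subtype.val ((hG.isAcyclic.subsingleton_path v o).elim ⟨q, hq⟩ ⟨p v, hp v⟩)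
  have hpar : ∀ u v, G.Adj u v → G.dist o v = G.dist o u + 1 → u = (p v).snd := by
    intro u v huv hd
    have h1 : (SimpleGraph.Walk.cons huv.symm (p u)).IsPath := by
      apply SimpleGraph.Walk.isPath_of_length_eq_dist
      rw [SimpleGraph.Walk.length_cons, hlen, SimpleGraph.dist_comm, ← hd, SimpleGraph.dist_comm]
    rw [← huniq v _ h1, SimpleGraph.Walk.snd_cons]
  have hadj : ∀ v, v ≠ o → G.Adj v (p v).snd := by
    intro v hv
    exact SimpleGraph.Walk.adj_snd (SimpleGraph.Walk.not_nil_of_ne hv)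
  refine ⟨fun v => (p v).snd, fun v hv => ⟨hadj v hv, ?_⟩, ?_, ?_⟩
  · have h1 := SimpleGraph.Walk.length_tail_add_one (SimpleGraph.Walk.not_nil_of_ne (p := p v) hv)
    have h2 := SimpleGraph.dist_le (p v).tail
    rw [hlen v] at h1
    have h3 := hG.dist_eq_dist_add_one_of_adj o (hadj v hv)
    rw [SimpleGraph.dist_comm (u := v)] at h1
    rw [SimpleGraph.dist_comm] at h2
    change G.dist o v = G.dist o (p v).snd + 1
    omega
  · intro u v huv
    rcases hG.dist_eq_dist_add_one_of_adj o huv with h | h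
    · refine Or.inr ⟨?_, hpar v u huv.symm h⟩
      rintro rfl
      simp at h
    · refine Or.inl ⟨?_, hpar u v huv h⟩
      rintro rfl
      simp at h
  · intro Δ ho hc v hv hvo
    obtain ⟨q, hq⟩ := hc.exists_isPath ⟨v, hv⟩ ⟨o, ho⟩
    have h1 : (q.map (SimpleGraph.Embedding.induce (Δ : Set V)).toHom).IsPath :=
      hq.map Subtype.val_injective
    have h2 : (q.map (SimpleGraph.Embedding.induce (Δ : Set V)).toHom).support =
        (p v).support := congrArg _ (huniq v _ h1)
    have h3 : (p v).snd ∈ (p v).support := SimpleGraph.Walk.getVert_mem_support _ _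
    rw [← h2, SimpleGraph.Walk.support_map, List.mem_map] at h3
    obtain ⟨w, -, hw⟩ := h3
    change (p v).snd ∈ Δ
    rw [← hw]
    exact w.2

open Classical in
/-- The edges of `G` with both endpoints in `Δ`. -/
def innerEdges (G : SimpleGraph V) [G.LocallyFinite] (Δ : Finset V) : Finset (Sym2 V) :=
  (touchingEdges G Δ).filter fun b => ∀ u ∈ b, u ∈ Δ

open Classical in
/-- The number of neighbours of `u` outside `Δ`. -/
def outDegree (G : SimpleGraph V) [G.LocallyFinite] (Δ : Finset V) (u : V) : ℕ :=
  ((G.neighborFinset u).filter (· ∉ Δ)).card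

theorem mem_innerEdges (G : SimpleGraph V) [G.LocallyFinite] (Δ : Finset V) (b : Sym2 V) :
    b ∈ innerEdges G Δ ↔ b ∈ G.edgeSet ∧ ∀ u ∈ b, u ∈ Δ := by
  simp only [innerEdges, Finset.mem_filter, mem_touchingEdges]
  constructor
  · exact fun h => ⟨h.1.1, h.2⟩
  · intro h
    refine ⟨⟨h.1, ?_⟩, h.2⟩
    induction b with
    | h a b => exact ⟨a, h.2 a (by simp), by simp⟩

/-- The unnormalized weight of the spins in `Δ` when every vertex outside `Δ` that is adjacent
to `Δ` sends the message `x`. -/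
def messageWeight (G : SimpleGraph V) [G.LocallyFinite] (Q : TransferOperator k)
    (x : Lattice k → ℝ) (Δ : Finset V) (ω : Config V k) : ℝ :=
  (∏ b ∈ innerEdges G Δ, edgeWeight Q ω b) * ∏ u ∈ Δ, x (ω u) ^ outDegree G Δ u

theorem edgeWeight_pos (Q : TransferOperator k) (ω : Config V k) (b : Sym2 V) :
    0 < edgeWeight Q ω b := by
  induction b with
  | h a b => exact Q.pos _

theorem messageWeight_pos (G : SimpleGraph V) [G.LocallyFinite] (Q : TransferOperator k)
    {x : Lattice k → ℝ} (hx : ∀ j, 0 < x j) (Δ : Finset V) (ω : Config V k) :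
    0 < messageWeight G Q x Δ ω :=
  mul_pos (Finset.prod_pos fun b _ => edgeWeight_pos Q ω b)
    (Finset.prod_pos fun _ _ => pow_pos (hx _) _)

open Classical in
/-- Along a parent function, the message weight is a product of transition weights. -/
theorem messageWeight_eq_prod_parent {G : SimpleGraph V} [G.LocallyFinite]
    {d : ℕ} (hReg : G.IsRegularOfDegree (d + 1)) (Q : TransferOperator k) {x : Lattice k → ℝ}
    (hx : ∀ j, 0 < x j) {o : V} {par : V → V}
    (hpar : ∀ v, v ≠ o → G.Adj v (par v) ∧ G.dist o v = G.dist o (par v) + 1)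
    (hadj : ∀ u v, G.Adj u v → (v ≠ o ∧ u = par v) ∨ (u ≠ o ∧ v = par u))
    {Δ : Finset V} (ho : o ∈ Δ) (hΔ : ∀ v ∈ Δ, v ≠ o → par v ∈ Δ) (ω : Config V k) :
    messageWeight G Q x Δ ω = x (ω o) ^ (d + 1) *
      ∏ v ∈ Δ.erase o, (Q (ω (par v) - ω v) * x (ω v) ^ d / x (ω (par v))) := by
  have hedges : innerEdges G Δ = (Δ.erase o).image fun v => s(v, par v) := by
    ext b
    rw [mem_innerEdges, Finset.mem_image]
    constructor
    · rintro ⟨hb, hin⟩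
      induction b with
      | h a b =>
        rcases hadj a b hb with ⟨h1, rfl⟩ | ⟨h1, rfl⟩
        · exact ⟨b, Finset.mem_erase.2 ⟨h1, hin b (by simp)⟩, Sym2.eq_swap⟩
        · exact ⟨a, Finset.mem_erase.2 ⟨h1, hin a (by simp)⟩, rfl⟩
    · rintro ⟨v, hv, rfl⟩
      obtain ⟨h1, h2⟩ := Finset.mem_erase.1 hv
      refine ⟨(hpar v h1).1, ?_⟩
      intro u hu
      rcases Sym2.mem_iff.1 hu with rfl | rfl
      exacts [h2, hΔ v h2 h1]
  have hinj : Set.InjOn (fun v => s(v, par v)) (Δ.erase o : Finset V) := by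
    intro v hv w hw h
    have h1 := hpar v (Finset.mem_erase.1 hv).1
    have h2 := hpar w (Finset.mem_erase.1 hw).1
    rcases Sym2.eq_iff.1 h with h | ⟨h3, h4⟩
    · exact h.1
    · rw [← h3] at h2
      rw [h4] at h1
      omega
  have hdeg : ∀ u ∈ Δ, ((Δ.erase o).filter fun v => par v = u).card + outDegree G Δ u
      + (if u = o then 0 else 1) = d + 1 := by
    intro u hu
    have hcup : G.neighborFinset u = ((Δ.erase o).filter fun v => par v = u) ∪
        ((G.neighborFinset u).filter (· ∉ Δ)) ∪ (if u = o then ∅ else {par u}) := by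
      ext v
      simp only [Finset.mem_union, Finset.mem_filter, Finset.mem_erase,
        SimpleGraph.mem_neighborFinset]
      constructor
      · intro huv
        by_cases hv : v ∈ Δ
        · rcases hadj u v huv with ⟨h1, rfl⟩ | ⟨h1, rfl⟩
          · exact Or.inl (Or.inl ⟨⟨h1, hv⟩, rfl⟩)
          · right; simp [h1]
        · exact Or.inl (Or.inr ⟨huv, hv⟩)
      · rintro ((⟨⟨h1, -⟩, rfl⟩ | h) | h)
        · exact (hpar v h1).1.symm
        · exact h.1
        · split_ifs at h with h1
          · simp at h
          · rw [Finset.mem_singleton.1 h]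
            exact (hpar u h1).1
    have hd1 : Disjoint ((Δ.erase o).filter fun v => par v = u)
        ((G.neighborFinset u).filter (· ∉ Δ)) := by
      rw [Finset.disjoint_left]
      intro v hv hv'
      exact (Finset.mem_filter.1 hv').2 (Finset.mem_erase.1 (Finset.mem_filter.1 hv).1).2
    have hd2 : Disjoint (((Δ.erase o).filter fun v => par v = u) ∪
        ((G.neighborFinset u).filter (· ∉ Δ))) (if u = o then ∅ else {par u}) := by
      split_ifs with h1
      · simp
      · rw [Finset.disjoint_singleton_right, Finset.mem_union, Finset.mem_filter,
          Finset.mem_filter]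
        rintro (⟨h2, h3⟩ | h)
        · have h4 := (hpar u h1).2
          have h5 := (hpar _ (Finset.mem_erase.1 h2).1).2
          rw [h3] at h5
          omega
        · exact h.2 (hΔ u hu h1)
    have hcard := hReg u
    rw [← SimpleGraph.card_neighborFinset_eq_degree, hcup, Finset.card_union_of_disjoint hd2,
      Finset.card_union_of_disjoint hd1] at hcard
    rw [← hcard, outDegree]
    split_ifs <;> simp
  have hfib : ∏ v ∈ Δ.erase o, x (ω (par v)) =
      ∏ u ∈ Δ, x (ω u) ^ ((Δ.erase o).filter fun v => par v = u).card := by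
    rw [← Finset.prod_fiberwise_of_maps_to (t := Δ) (g := par)
      (fun v hv => hΔ v (Finset.mem_erase.1 hv).2 (Finset.mem_erase.1 hv).1)]
    refine Finset.prod_congr rfl fun u _ => ?_
    rw [← Finset.prod_const]
    refine Finset.prod_congr rfl fun v hv => ?_
    rw [(Finset.mem_filter.1 hv).2]
  have hout : (∏ u ∈ Δ, x (ω u) ^ outDegree G Δ u) * ∏ v ∈ Δ.erase o, x (ω (par v)) =
      x (ω o) ^ (d + 1) * ∏ v ∈ Δ.erase o, x (ω v) ^ d := by
    rw [hfib, ← Finset.prod_mul_distrib, ← Finset.mul_prod_erase Δ _ ho]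
    congr 1
    · rw [← pow_add]
      have := hdeg o ho
      simp only [if_true] at this
      congr 1
      omega
    · refine Finset.prod_congr rfl fun v hv => ?_
      rw [← pow_add]
      have := hdeg v (Finset.mem_erase.1 hv).2
      rw [if_neg (Finset.mem_erase.1 hv).1] at this
      congr 1
      omega
  rw [messageWeight, hedges, Finset.prod_image hinj]
  simp only [div_eq_mul_inv]
  rw [Finset.prod_mul_distrib, Finset.prod_mul_distrib, Finset.prod_inv_distrib]
  have hne : ∏ v ∈ Δ.erase o, x (ω (par v)) ≠ 0 :=
    Finset.prod_ne_zero_iff.2 fun v _ => (hx _).ne'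
  have hQ : ∏ v ∈ Δ.erase o, edgeWeight Q ω s(v, par v) =
      ∏ v ∈ Δ.erase o, Q (ω (par v) - ω v) := by
    refine Finset.prod_congr rfl fun v _ => ?_
    rw [Sym2.eq_swap]
    rfl
  rw [hQ]
  field_simp
  linear_combination (∏ v ∈ Δ.erase o, Q (ω (par v) - ω v)) * hout

end

section

variable {V : Type*} {k : ℕ}

/-- A positive function `x` whose `d`-th power is a spatially homogeneous normalizable boundary
law for `Q`, with eigenvalue `D` and normalization `Z`. -/
structure IsBoundaryLaw (d : ℕ) (Q : TransferOperator k) (x : Lattice k → ℝ) (D Z : ℝ) : Prop where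
  pos : ∀ j, 0 < x j
  hasSum : ∀ a, HasSum (fun j => Q (a - j) * x j ^ d) (D * x a)
  hasSum_pow : HasSum (fun j => x j ^ (d + 1)) Z

namespace IsBoundaryLaw

variable {d : ℕ} {Q : TransferOperator k} {x : Lattice k → ℝ} {D Z : ℝ}

theorem eigenvalue_pos (h : IsBoundaryLaw d Q x D Z) : 0 < D := by
  have h1 : 0 < D * x 0 :=
    (mul_pos (Q.pos _) (pow_pos (h.pos _) _)).trans_le (le_hasSum (h.hasSum 0) 0
      fun j _ => (mul_pos (Q.pos _) (pow_pos (h.pos _) _)).le)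
  exact pos_of_mul_pos_left h1 (h.pos 0).le

theorem normalization_pos (h : IsBoundaryLaw d Q x D Z) : 0 < Z :=
  (pow_pos (h.pos 0) (d + 1)).trans_le (le_hasSum h.hasSum_pow 0
      fun _ _ => (pow_pos (h.pos _) _).le)

theorem translate (h : IsBoundaryLaw d Q x D Z) (i : Lattice k) :
    IsBoundaryLaw d Q (fun j => x (j - i)) D Z where
  pos j := h.pos _
  hasSum a := by
    rw [← (Equiv.addRight i).hasSum_iff]
    convert h.hasSum (a - i) using 2 with j
    simp [sub_sub, add_comm]
  hasSum_pow := by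
    rw [← (Equiv.addRight i).hasSum_iff]
    convert h.hasSum_pow using 2 with j
    simp

/-- The transition probabilities of the Markov chain attached to a boundary law. -/
def transition (h : IsBoundaryLaw d Q x D Z) (a : Lattice k) : PMF (Lattice k) :=
  ⟨fun j => ENNReal.ofReal (Q (a - j) * x j ^ d / (D * x a)), by
    rw [← ENNReal.ofReal_one]
    have h0 : D * x a ≠ 0 := (mul_pos h.eigenvalue_pos (h.pos a)).ne'
    have h1 := (h.hasSum a).div_const (D * x a)
    rw [div_self h0] at h1
    rw [← h1.tsum_eq, ENNReal.ofReal_tsum_of_nonneg _ h1.summable]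
    · exact ENNReal.summable.hasSum
    · exact fun j => div_nonneg (mul_nonneg (Q.pos _).le (pow_nonneg (h.pos _).le _))
        (mul_pos h.eigenvalue_pos (h.pos a)).le⟩

/-- The single-site marginal attached to a boundary law. -/
def stationary (h : IsBoundaryLaw d Q x D Z) : PMF (Lattice k) :=
  ⟨fun j => ENNReal.ofReal (x j ^ (d + 1) / Z), by
    rw [← ENNReal.ofReal_one]
    have h1 := h.hasSum_pow.div_const Z
    rw [div_self h.normalization_pos.ne'] at h1
    rw [← h1.tsum_eq, ENNReal.ofReal_tsum_of_nonneg _ h1.summable]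
    · exact ENNReal.summable.hasSum
    · exact fun j => div_nonneg (pow_nonneg (h.pos _).le _) h.normalization_pos.le⟩

end IsBoundaryLaw

/-- The configurations that agree with `ω` on `Δ`. -/
def agreeOn (Δ : Finset V) (ω : Config V k) : Set (Config V k) :=
  {σ | ∀ v ∈ Δ, σ v = ω v}

theorem measurableSet_agreeOn (Δ : Finset V) (ω : Config V k) :
    MeasurableSet (agreeOn Δ ω) := by
  have : agreeOn Δ ω = Set.pi (Δ : Set V) fun v => {ω v} := by
    ext σ
    simp [agreeOn]
  rw [this]
  exact MeasurableSet.pi Δ.countable_toSet fun v _ => measurableSet_singleton _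

/-- A finite measure on configurations is determined by its values on a cofinal family of
cylinders. -/
theorem ext_of_agreeOn {μ ν : Measure (Config V k)} [IsFiniteMeasure ν]
    (h : ∀ S : Finset V, ∃ Δ, S ⊆ Δ ∧ ∀ ω, μ (agreeOn Δ ω) = ν (agreeOn Δ ω)) : μ = ν := by
  classical
  refine IsProjectiveLimit.unique (P := fun I : Finset V => ν.map I.restrict) ?_ fun I => rfl
  intro I
  obtain ⟨Δ, hI, hΔ⟩ := h I
  let r : Config V k → Δ → Lattice k := Finset.restrict (π := fun _ => Lattice k) Δ
  let r' : (Δ → Lattice k) → I → Lattice k := Finset.restrict₂ (π := fun _ => Lattice k) hI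
  have hr : Measurable r := Finset.measurable_restrict Δ
  have hr' : Measurable r' := Finset.measurable_restrict₂ hI
  have key : μ.map r = ν.map r := by
    refine Measure.ext_of_singleton fun a => ?_
    rw [Measure.map_apply hr (measurableSet_singleton _),
      Measure.map_apply hr (measurableSet_singleton _)]
    have : r ⁻¹' {a} = agreeOn Δ (fun v => if hv : v ∈ Δ then a ⟨v, hv⟩ else 0) := by
      ext σ
      simp only [Set.mem_preimage, Set.mem_singleton_iff, agreeOn, Set.mem_ofPred_eq]
      constructor
      · rintro rfl v hv
        rw [dif_pos hv]
        rfl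
      · intro h
        funext v
        have := h v v.2
        rw [dif_pos v.2] at this
        exact this
    rw [this, hΔ]
  have h1 := congrArg (Measure.map r') key
  rwa [Measure.map_map hr' hr, Measure.map_map hr' hr] at h1

/-- The value at `v` of the configuration generated from the random maps `ξ` by following the
parent function for at most `n` steps. -/
def unfoldChain [DecidableEq V] (o : V) (par : V → V) :
    ℕ → (V × Lattice k → Lattice k) → V → Lattice k
  | 0, _, _ => 0
  | n + 1, ξ, v => ξ (v, if v = o then 0 else unfoldChain o par n ξ (par v))

theorem measurable_unfoldChain [DecidableEq V] (o : V) (par : V → V) (n : ℕ) (v : V) :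
    Measurable fun ξ : V × Lattice k → Lattice k => unfoldChain o par n ξ v := by
  induction n generalizing v with
  | zero => exact measurable_const
  | succ n ih =>
    have h1 : Measurable fun p : (V × Lattice k → Lattice k) × Lattice k => p.1 (v, p.2) :=
      measurable_from_prod_countable_left fun a => measurable_pi_apply (v, a)
    have h2 : Measurable fun ξ : V × Lattice k → Lattice k =>
        if v = o then (0 : Lattice k) else unfoldChain o par n ξ (par v) := by
      split_ifs
      · exact measurable_const
      · exact ih _
    exact h1.comp (measurable_id.prodMk h2)

open Classical in
/-- For every root `o`, a boundary law defines a probability measure with the prescribed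
marginals on finite connected sets containing `o`. -/
theorem IsBoundaryLaw.exists_measure_of_root {d : ℕ} {Q : TransferOperator k}
    {x : Lattice k → ℝ} {D Z : ℝ} (h : IsBoundaryLaw d Q x D Z) {G : SimpleGraph V}
    [G.LocallyFinite] (hG : G.IsTree) (hReg : G.IsRegularOfDegree (d + 1)) (o : V) :
    ∃ μ : Measure (Config V k), IsProbabilityMeasure μ ∧
      ∀ Δ : Finset V, o ∈ Δ → (G.induce (Δ : Set V)).Connected → ∀ ω,
        μ (agreeOn Δ ω) =
          ENNReal.ofReal (messageWeight G Q x Δ ω / (Z * D ^ (Δ.card - 1))) := by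
  obtain ⟨par, hpar, hadj, hconn⟩ := exists_parent hG o
  let κ : V × Lattice k → PMF (Lattice k) :=
    fun p => if p.1 = o then h.stationary else h.transition p.2
  let ν := Measure.infinitePi fun p => (κ p).toMeasure
  let chain : (V × Lattice k → Lattice k) → Config V k :=
    fun ξ v => unfoldChain o par (G.dist o v + 1) ξ v
  have hchain : ∀ ξ v, chain ξ v = ξ (v, if v = o then 0 else chain ξ (par v)) := by
    intro ξ v
    change ξ (v, if v = o then 0 else unfoldChain o par (G.dist o v) ξ (par v)) = _
    split_ifs with hv
    · rfl
    · rw [(hpar v hv).2]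
  have hmeas : Measurable chain :=
    measurable_pi_lambda _ fun v => measurable_unfoldChain o par _ v
  refine ⟨ν.map chain, Measure.isProbabilityMeasure_map hmeas.aemeasurable, ?_⟩
  intro Δ ho hΔ ω
  have hpc := hconn Δ ho hΔ
  rw [Measure.map_apply hmeas (measurableSet_agreeOn Δ ω)]
  let ctx : V → V × Lattice k := fun v => (v, if v = o then 0 else ω (par v))
  have hctx : Function.Injective ctx := fun v w hvw => congrArg Prod.fst hvw
  have hset : chain ⁻¹' agreeOn Δ ω = Set.pi (Δ.image ctx : Finset _) fun p => {ω p.1} := by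
    ext ξ
    simp only [Set.mem_preimage, agreeOn, Set.mem_ofPred_eq, Set.mem_pi, Finset.coe_image,
      Set.mem_image, Finset.mem_coe, Set.mem_singleton_iff]
    constructor
    · rintro hξ _ ⟨v, hv, rfl⟩
      change ξ (v, if v = o then 0 else ω (par v)) = ω v
      rw [← hξ v hv, hchain]
      split_ifs with hvo
      · rfl
      · rw [hξ _ (hpc v hv hvo)]
    · intro hξ
      have key : ∀ n v, G.dist o v = n → v ∈ Δ → chain ξ v = ω v := by
        intro n
        induction n with
        | zero =>
          intro v hn hv
          obtain rfl : o = v := hG.connected.dist_eq_zero_iff.1 hn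
          have := hξ _ ⟨o, hv, rfl⟩
          rw [hchain]
          simpa [ctx] using this
        | succ n ih =>
          intro v hn hv
          have hvo : v ≠ o := by
            rintro rfl
            simp at hn
          have h1 := hξ _ ⟨v, hv, rfl⟩
          have h2 := ih (par v) (by have := (hpar v hvo).2; omega) (hpc v hv hvo)
          rw [hchain, if_neg hvo, h2]
          simpa [ctx, hvo] using h1
      exact fun v hv => key _ v rfl hv
  rw [hset, Measure.infinitePi_pi _ fun _ _ => measurableSet_singleton _,
    Finset.prod_image hctx.injOn, ← Finset.mul_prod_erase Δ _ ho]
  have h1 : (κ (ctx o)).toMeasure {ω (ctx o).1} = ENNReal.ofReal (x (ω o) ^ (d + 1) / Z) := by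
    rw [PMF.toMeasure_apply_singleton _ _ (measurableSet_singleton _)]
    simp only [κ, ctx, if_true]
    rfl
  have h2 : ∀ v ∈ Δ.erase o, (κ (ctx v)).toMeasure {ω (ctx v).1} =
      ENNReal.ofReal (Q (ω (par v) - ω v) * x (ω v) ^ d / (D * x (ω (par v)))) := by
    intro v hv
    have hvo := (Finset.mem_erase.1 hv).1
    rw [PMF.toMeasure_apply_singleton _ _ (measurableSet_singleton _)]
    simp only [κ, ctx, if_neg hvo]
    rfl
  have h3 : ∀ v, 0 ≤ Q (ω (par v) - ω v) * x (ω v) ^ d / (D * x (ω (par v))) := fun v =>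
    div_nonneg (mul_nonneg (Q.pos _).le (pow_nonneg (h.pos _).le _))
      (mul_pos h.eigenvalue_pos (h.pos _)).le
  rw [h1, Finset.prod_congr rfl h2, ← ENNReal.ofReal_prod_of_nonneg fun v _ => h3 v,
    ← ENNReal.ofReal_mul (div_nonneg (pow_nonneg (h.pos _).le _) h.normalization_pos.le),
    messageWeight_eq_prod_parent hReg Q h.pos hpar hadj ho hpc]
  congr 1
  have h4 : ∏ v ∈ Δ.erase o, Q (ω (par v) - ω v) * x (ω v) ^ d / (D * x (ω (par v))) =
      (∏ v ∈ Δ.erase o, Q (ω (par v) - ω v) * x (ω v) ^ d / x (ω (par v))) /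
        D ^ (Δ.card - 1) := by
    rw [← Finset.card_erase_of_mem ho, ← Finset.prod_const, ← Finset.prod_div_distrib]
    refine Finset.prod_congr rfl fun v _ => ?_
    rw [div_div, mul_comm D]
  rw [h4, div_mul_div_comm]

/-- `μ` has the marginals prescribed by `x` on all finite connected vertex sets. -/
def HasMessageMarginals (G : SimpleGraph V) [G.LocallyFinite] (Q : TransferOperator k)
    (x : Lattice k → ℝ) (D Z : ℝ) (μ : Measure (Config V k)) : Prop :=
  ∀ Δ : Finset V, (G.induce (Δ : Set V)).Connected → ∀ ω,
    μ (agreeOn Δ ω) = ENNReal.ofReal (messageWeight G Q x Δ ω / (Z * D ^ (Δ.card - 1)))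

theorem exists_connected_superset {G : SimpleGraph V} (hG : G.Connected) (S : Finset V) :
    ∃ Δ : Finset V, S ⊆ Δ ∧ (G.induce (Δ : Set V)).Connected := by
  classical
  obtain ⟨o⟩ := hG.nonempty
  obtain ⟨Δ, h1, h2⟩ := SimpleGraph.extend_finset_to_connected hG.preconnected
    (Finset.insert_nonempty o S)
  exact ⟨Δ, (Finset.subset_insert o S).trans h1, h2⟩

theorem IsBoundaryLaw.exists_measure {d : ℕ} {Q : TransferOperator k}
    {x : Lattice k → ℝ} {D Z : ℝ} (h : IsBoundaryLaw d Q x D Z) {G : SimpleGraph V}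
    [G.LocallyFinite] (hG : G.IsTree) (hReg : G.IsRegularOfDegree (d + 1)) :
    ∃ μ : Measure (Config V k), IsProbabilityMeasure μ ∧ HasMessageMarginals G Q x D Z μ := by
  classical
  choose μ hμ hm using h.exists_measure_of_root hG hReg
  obtain ⟨o⟩ := hG.connected.nonempty
  refine ⟨μ o, hμ o, fun Δ hΔ ω => ?_⟩
  obtain ⟨⟨o', ho'⟩⟩ := hΔ.nonempty
  have : μ o = μ o' := by
    have := hμ o'
    refine ext_of_agreeOn fun S => ?_
    obtain ⟨Δ', h1, h2⟩ := exists_connected_superset hG.connected (insert o (insert o' S))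
    refine ⟨Δ', fun v hv => h1 (by simp [hv]), fun ω => ?_⟩
    rw [hm o Δ' (h1 (by simp)) h2, hm o' Δ' (h1 (by simp)) h2]
  rw [this, hm o' Δ ho' hΔ]

theorem HasMessageMarginals.unique {G : SimpleGraph V} [G.LocallyFinite] {Q : TransferOperator k}
    {x : Lattice k → ℝ} {D Z : ℝ} {μ ν : Measure (Config V k)} [IsFiniteMeasure ν]
    (hG : G.Connected) (hμ : HasMessageMarginals G Q x D Z μ)
    (hν : HasMessageMarginals G Q x D Z ν) : μ = ν := by
  refine ext_of_agreeOn fun S => ?_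
  obtain ⟨Δ, h1, h2⟩ := exists_connected_superset hG S
  exact ⟨Δ, h1, fun ω => by rw [hμ Δ h2, hν Δ h2]⟩

/-- The image of the measure of `x` under a translation of the spins is the measure of the
translate of `x`. -/
theorem HasMessageMarginals.translate {G : SimpleGraph V} [G.LocallyFinite]
    {Q : TransferOperator k} {x : Lattice k → ℝ} {D Z : ℝ} {μ : Measure (Config V k)}
    (hμ : HasMessageMarginals G Q x D Z μ) (i : Lattice k) :
    HasMessageMarginals G Q (fun j => x (j - i)) D Z (μ.map fun ω v => ω v + i) := by
  intro Δ hΔ ω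
  have hm : Measurable fun (ω : Config V k) v => ω v + i :=
    measurable_pi_lambda _ fun v => 
      (measurable_of_countable fun a : Lattice k => a + i).comp (measurable_pi_apply v)
  rw [Measure.map_apply hm (measurableSet_agreeOn Δ ω)]
  have h1 : (fun (ω : Config V k) v => ω v + i) ⁻¹' agreeOn Δ ω = agreeOn Δ fun v => ω v - i := by
    ext σ
    simp [agreeOn, eq_sub_iff_add_eq]
  rw [h1, hμ Δ hΔ]
  congr 2
  rw [messageWeight, messageWeight]
  congr 1
  refine Finset.prod_congr rfl fun b _ => ?_
  induction b with
  | h u v =>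
    change Q (ω u - i - (ω v - i)) = Q (ω u - ω v)
    rw [sub_sub_sub_cancel_right]

theorem messageWeight_map {G : SimpleGraph V} [G.LocallyFinite] (Q : TransferOperator k)
    (x : Lattice k → ℝ) (φ : G ≃g G) (Δ : Finset V) (ω : Config V k) :
    messageWeight G Q x (Δ.map φ.toEquiv.toEmbedding) (fun v => ω (φ.symm v)) =
      messageWeight G Q x Δ ω := by
  classical
  have hout : ∀ u, outDegree G (Δ.map φ.toEquiv.toEmbedding) (φ u) = outDegree G Δ u := by
    intro u
    refine Finset.card_nbij' φ.symm φ ?_ ?_ ?_ ?_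
    · intro v hv
      simp only [Finset.coe_filter, SimpleGraph.mem_neighborFinset, Set.mem_ofPred_eq,
        Finset.mem_map_equiv] at hv ⊢
      refine ⟨?_, hv.2⟩
      rw [← φ.map_adj_iff]
      simpa using hv.1
    · intro v hv
      simp only [Finset.coe_filter, SimpleGraph.mem_neighborFinset, Set.mem_ofPred_eq,
        Finset.mem_map_equiv] at hv ⊢
      refine ⟨φ.map_adj_iff.2 hv.1, ?_⟩
      have : φ.toEquiv.symm (φ v) = v := φ.symm_apply_apply v
      rw [this]
      exact hv.2
    · exact fun v _ => φ.apply_symm_apply v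
    · exact fun v _ => φ.symm_apply_apply v
  rw [messageWeight, messageWeight, Finset.prod_map]
  congr 1
  · refine Finset.prod_nbij' (Sym2.map φ.symm) (Sym2.map φ) ?_ ?_ ?_ ?_ ?_
    · intro b hb
      rw [mem_innerEdges] at hb ⊢
      induction b with
      | h u v =>
        simp only [Sym2.map_mk, Sym2.mem_iff, forall_eq_or_imp, forall_eq, SimpleGraph.mem_edgeSet,
          Finset.mem_map_equiv] at hb ⊢
        refine ⟨?_, hb.2⟩
        rw [← φ.map_adj_iff]
        simpa using hb.1
    · intro b hb
      rw [mem_innerEdges] at hb ⊢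
      induction b with
      | h u v =>
        have h1 : ∀ v, φ.toEquiv.symm (φ v) = v := φ.symm_apply_apply
        simp only [Sym2.map_mk, Sym2.mem_iff, forall_eq_or_imp, forall_eq, SimpleGraph.mem_edgeSet,
          Finset.mem_map_equiv, h1] at hb ⊢
        exact ⟨φ.map_adj_iff.2 hb.1, hb.2⟩
    · intro b _
      induction b with
      | h u v => simp
    · intro b _
      induction b with
      | h u v => simp
    · intro b _
      induction b with
      | h u v => rfl
  · refine Finset.prod_congr rfl fun u _ => ?_
    have h1 : φ.symm (φ u) = u := φ.symm_apply_apply u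
    have h2 := hout u
    change x (ω (φ.symm (φ u))) ^ outDegree G _ (φ u) = _
    rw [h1, h2]

theorem connected_induce_map {G : SimpleGraph V} (φ : G ≃g G) {Δ : Finset V}
    (hΔ : (G.induce (Δ : Set V)).Connected) :
    (G.induce ((Δ.map φ.toEquiv.toEmbedding : Finset V) : Set V)).Connected := by
  let f : G.induce (Δ : Set V) →g
      G.induce ((Δ.map φ.toEquiv.toEmbedding : Finset V) : Set V) :=
    ⟨fun v => ⟨φ v, Finset.mem_map_of_mem _ v.2⟩, fun h => φ.map_adj_iff.2 h⟩
  refine hΔ.map f ?_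
  rintro ⟨v, hv⟩
  obtain ⟨u, hu, rfl⟩ := Finset.mem_map.1 hv
  exact ⟨⟨u, hu⟩, rfl⟩

theorem HasMessageMarginals.isAutInvariant {G : SimpleGraph V} [G.LocallyFinite]
    {Q : TransferOperator k} {x : Lattice k → ℝ} {D Z : ℝ} {μ : Measure (Config V k)}
    [IsFiniteMeasure μ] (hG : G.Connected) (hμ : HasMessageMarginals G Q x D Z μ) :
    IsAutInvariant G μ := by
  intro φ
  refine HasMessageMarginals.unique hG (fun Δ hΔ ω => ?_) hμ
  have hm : Measurable fun (ω : Config V k) v => ω (φ v) :=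
    measurable_pi_lambda _ fun v => measurable_pi_apply _
  rw [Measure.map_apply hm (measurableSet_agreeOn Δ ω)]
  have h1 : (fun (ω : Config V k) v => ω (φ v)) ⁻¹' agreeOn Δ ω =
      agreeOn (Δ.map φ.toEquiv.toEmbedding) fun v => ω (φ.symm v) := by
    ext σ
    simp only [agreeOn, Set.mem_preimage, Set.mem_ofPred_eq, Finset.forall_mem_map]
    refine forall₂_congr fun v _ => ?_
    have : φ.symm (φ v) = v := φ.symm_apply_apply v
    change _ ↔ σ (φ v) = ω (φ.symm (φ v))
    rw [this]
  rw [h1, hμ _ (connected_induce_map φ hΔ), messageWeight_map, Finset.card_map]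

end

section

variable {V : Type*} {k : ℕ}

theorem glue_of_mem {Λ : Finset V} (ζ : Λ → Lattice k) (ω : Config V k) {v : V} (hv : v ∈ Λ) :
    glue Λ ζ ω v = ζ ⟨v, hv⟩ := by
  rw [glue, dif_pos hv]

theorem glue_of_notMem {Λ : Finset V} (ζ : Λ → Lattice k) (ω : Config V k) {v : V} (hv : v ∉ Λ) :
    glue Λ ζ ω v = ω v := by
  rw [glue, dif_neg hv]

theorem edgeWeight_congr (Q : TransferOperator k) {ω ω' : Config V k} {b : Sym2 V}
    (h : ∀ v ∈ b, ω v = ω' v) : edgeWeight Q ω b = edgeWeight Q ω' b := by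
  induction b with
  | h u v =>
    change Q (ω u - ω v) = Q (ω' u - ω' v)
    rw [h u (by simp), h v (by simp)]

open Classical in
/-- The part of the message weight in `Δ` that only involves the spins outside `Λ`. -/
def outerWeight (G : SimpleGraph V) [G.LocallyFinite] (Q : TransferOperator k)
    (x : Lattice k → ℝ) (Λ Δ : Finset V) (ω : Config V k) : ℝ :=
  (∏ b ∈ innerEdges G Δ \ touchingEdges G Λ, edgeWeight Q ω b) *
    ∏ u ∈ Δ \ Λ, x (ω u) ^ outDegree G Δ u

theorem outerWeight_pos (G : SimpleGraph V) [G.LocallyFinite] (Q : TransferOperator k)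
    {x : Lattice k → ℝ} (hx : ∀ j, 0 < x j) (Λ Δ : Finset V) (ω : Config V k) :
    0 < outerWeight G Q x Λ Δ ω :=
  mul_pos (Finset.prod_pos fun b _ => edgeWeight_pos Q ω b)
    (Finset.prod_pos fun _ _ => pow_pos (hx _) _)

theorem outerWeight_glue (G : SimpleGraph V) [G.LocallyFinite] (Q : TransferOperator k)
    (x : Lattice k → ℝ) (Λ Δ : Finset V) (ζ : Λ → Lattice k) (ω : Config V k) :
    outerWeight G Q x Λ Δ (glue Λ ζ ω) = outerWeight G Q x Λ Δ ω := by
  classical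
  rw [outerWeight, outerWeight]
  congr 1
  · refine Finset.prod_congr rfl fun b hb => edgeWeight_congr Q fun v hv => ?_
    obtain ⟨h1, h2⟩ := Finset.mem_sdiff.1 hb
    refine glue_of_notMem ζ ω fun hvΛ => h2 ?_
    exact (mem_touchingEdges G Λ b).2 ⟨((mem_innerEdges G Δ b).1 h1).1, v, hvΛ, hv⟩
  · refine Finset.prod_congr rfl fun u hu => ?_
    rw [glue_of_notMem ζ ω (Finset.mem_sdiff.1 hu).2]

/-- If `Δ` contains `Λ` and all its neighbours, the weight in `Δ` is the product of the weight of
the edges that meet `Λ` and of a function of the spins outside `Λ`. -/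
theorem ofReal_messageWeight {G : SimpleGraph V} [G.LocallyFinite] (Q : TransferOperator k)
    (x : Lattice k → ℝ) {Λ Δ : Finset V} (hΛ : Λ ⊆ Δ)
    (hN : ∀ u ∈ Λ, ∀ v, G.Adj u v → v ∈ Δ) (ω : Config V k) :
    ENNReal.ofReal (messageWeight G Q x Δ ω) =
      volumeWeight G Q Λ ω * ENNReal.ofReal (outerWeight G Q x Λ Δ ω) := by
  classical
  have h1 : touchingEdges G Λ ⊆ innerEdges G Δ := by
    intro b hb
    obtain ⟨hb1, u, hu, hub⟩ := (mem_touchingEdges G Λ b).1 hb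
    refine (mem_innerEdges G Δ b).2 ⟨hb1, fun v hv => ?_⟩
    by_cases huv : v = u
    · exact huv ▸ hΛ hu
    · have : b = s(u, v) := (Sym2.mem_and_mem_iff (Ne.symm huv)).1 ⟨hub, hv⟩
      rw [this] at hb1
      exact hN u hu v hb1
  have h2 : ∀ u ∈ Λ, outDegree G Δ u = 0 := by
    intro u hu
    rw [outDegree, Finset.card_eq_zero, Finset.filter_eq_empty_iff]
    intro v hv
    simpa using hN u hu v (by simpa using hv)
  rw [volumeWeight, ← ENNReal.ofReal_prod_of_nonneg fun b _ => (edgeWeight_pos Q ω b).le,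
    ← ENNReal.ofReal_mul (Finset.prod_nonneg fun b _ => (edgeWeight_pos Q ω b).le)]
  congr 1
  rw [messageWeight, outerWeight, ← Finset.prod_sdiff h1, ← Finset.prod_sdiff hΛ,
    Finset.prod_eq_one (s := Λ) fun u hu => by rw [h2 u hu, pow_zero]]
  ring

theorem volumeWeight_pos (G : SimpleGraph V) [G.LocallyFinite] (Q : TransferOperator k)
    (Λ : Finset V) (ω : Config V k) : 0 < volumeWeight G Q Λ ω := by
  rw [volumeWeight, ← ENNReal.ofReal_prod_of_nonneg fun b _ => (edgeWeight_pos Q ω b).le]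
  exact ENNReal.ofReal_pos.2 (Finset.prod_pos fun b _ => edgeWeight_pos Q ω b)

theorem partitionFunction_pos (G : SimpleGraph V) [G.LocallyFinite] (Q : TransferOperator k)
    (Λ : Finset V) (ω : Config V k) : 0 < partitionFunction G Q Λ ω :=
  (volumeWeight_pos G Q Λ (glue Λ 0 ω)).trans_le (ENNReal.le_tsum (0 : Λ → Lattice k))

theorem measurable_glue (Λ : Finset V) (ζ : Λ → Lattice k) :
    Measurable fun ω : Config V k => glue Λ ζ ω := by
  refine measurable_pi_lambda _ fun v => ?_
  by_cases hv : v ∈ Λ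
  · simp only [glue_of_mem ζ _ hv, measurable_const]
  · simp only [glue_of_notMem ζ _ hv]
    exact measurable_pi_apply v

theorem measurable_volumeWeight (G : SimpleGraph V) [G.LocallyFinite] (Q : TransferOperator k)
    (Λ : Finset V) : Measurable fun ω : Config V k => volumeWeight G Q Λ ω := by
  refine Finset.measurable_prod _ fun b _ => ENNReal.measurable_ofReal.comp ?_
  induction b with
  | h u v =>
    have hu (u : V) : Measurable fun ω : Config V k => ω u := measurable_pi_apply u
    exact (measurable_of_countable fun p : Lattice k × Lattice k => Q (p.1 - p.2)).comp
      ((hu u).prodMk (hu v))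

theorem measurable_partitionFunction (G : SimpleGraph V) [G.LocallyFinite]
    (Q : TransferOperator k) (Λ : Finset V) :
    Measurable fun ω : Config V k => partitionFunction G Q Λ ω :=
  Measurable.tsum fun ζ => (measurable_volumeWeight G Q Λ).comp (measurable_glue Λ ζ)

theorem gibbsKernel_apply (G : SimpleGraph V) [G.LocallyFinite] (Q : TransferOperator k)
    (Λ : Finset V) (ω : Config V k) {A : Set (Config V k)} (hA : MeasurableSet A) :
    gibbsKernel G Q Λ ω A = (partitionFunction G Q Λ ω)⁻¹ *
      ∑' ζ : Λ → Lattice k, volumeWeight G Q Λ (glue Λ ζ ω) * A.indicator 1 (glue Λ ζ ω) := by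
  rw [gibbsKernel, Measure.smul_apply, Measure.sum_apply _ hA, smul_eq_mul]
  simp only [Measure.smul_apply, smul_eq_mul, Measure.dirac_apply' _ hA]

theorem measurable_gibbsKernel (G : SimpleGraph V) [G.LocallyFinite] (Q : TransferOperator k)
    (Λ : Finset V) : Measurable (gibbsKernel (k := k) G Q Λ) := by
  refine Measure.measurable_of_measurable_coe _ fun A hA => ?_
  simp only [gibbsKernel_apply G Q Λ _ hA]
  refine (measurable_partitionFunction G Q Λ).inv.mul (Measurable.tsum fun ζ => ?_)
  exact ((measurable_volumeWeight G Q Λ).comp (measurable_glue Λ ζ)).mul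
    ((measurable_one.indicator hA).comp (measurable_glue Λ ζ))

open Classical in
/-- Summing over the spins in `Λ`. -/
theorem tsum_measure_agreeOn_glue (μ : Measure (Config V k)) {Λ Δ : Finset V} (hΛ : Λ ⊆ Δ)
    (ω : Config V k) :
    ∑' ζ : Λ → Lattice k, μ (agreeOn Δ (glue Λ ζ ω)) = μ (agreeOn (Δ \ Λ) ω) := by
  rw [← measure_iUnion]
  · congr 1
    ext σ
    simp only [Set.mem_iUnion, agreeOn, Set.mem_ofPred_eq, Finset.mem_sdiff]
    constructor
    · rintro ⟨ζ, h⟩ v ⟨hv, hvΛ⟩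
      rw [h v hv, glue_of_notMem ζ ω hvΛ]
    · intro h
      refine ⟨fun v => σ v, fun v hv => ?_⟩
      by_cases hvΛ : v ∈ Λ
      · rw [glue_of_mem _ ω hvΛ]
      · rw [glue_of_notMem _ ω hvΛ, h v ⟨hv, hvΛ⟩]
  · intro ζ ζ' hne
    rw [Function.onFun, Set.disjoint_left]
    intro σ h1 h2
    refine hne (funext fun v => ?_)
    have h3 := h1 v (hΛ v.2)
    rw [h2 v (hΛ v.2), glue_of_mem _ ω v.2, glue_of_mem _ ω v.2] at h3
    exact h3.symm
  · exact fun ζ => measurableSet_agreeOn _ _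

theorem exists_connected_superset_neighbors {G : SimpleGraph V} [G.LocallyFinite]
    (hG : G.Connected) (S Λ : Finset V) :
    ∃ Δ : Finset V, S ⊆ Δ ∧ Λ ⊆ Δ ∧ (∀ u ∈ Λ, ∀ v, G.Adj u v → v ∈ Δ) ∧
      (G.induce (Δ : Set V)).Connected := by
  classical
  obtain ⟨Δ, h1, h2⟩ := exists_connected_superset hG (S ∪ (Λ ∪ Λ.biUnion fun u => G.neighborFinset u))
  refine ⟨Δ, fun v hv => h1 (by simp [hv]), fun v hv => h1 (by simp [hv]), fun u hu v huv => ?_, h2⟩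
  refine h1 (Finset.mem_union_right _ (Finset.mem_union_right _ ?_))
  exact Finset.mem_biUnion.2 ⟨u, hu, by simpa using huv⟩

variable {d : ℕ} {Q : TransferOperator k} {x : Lattice k → ℝ} {D Z : ℝ}

theorem HasMessageMarginals.measure_agreeOn {G : SimpleGraph V} [G.LocallyFinite]
    (h : IsBoundaryLaw d Q x D Z) {μ : Measure (Config V k)}
    (hμ : HasMessageMarginals G Q x D Z μ) {Λ Δ : Finset V} (hΛ : Λ ⊆ Δ)
    (hN : ∀ u ∈ Λ, ∀ v, G.Adj u v → v ∈ Δ) (hΔ : (G.induce (Δ : Set V)).Connected)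
    (ω : Config V k) :
    μ (agreeOn Δ ω) = volumeWeight G Q Λ ω *
      ENNReal.ofReal (outerWeight G Q x Λ Δ ω / (Z * D ^ (Δ.card - 1))) := by
  rw [hμ Δ hΔ, div_eq_mul_inv, ENNReal.ofReal_mul (messageWeight_pos G Q h.pos Δ ω).le,
    ofReal_messageWeight Q x hΛ hN, div_eq_mul_inv,
    ENNReal.ofReal_mul (outerWeight_pos G Q h.pos Λ Δ ω).le, mul_assoc]

open Classical in
theorem HasMessageMarginals.measure_agreeOn_sdiff {G : SimpleGraph V} [G.LocallyFinite]
    (h : IsBoundaryLaw d Q x D Z) {μ : Measure (Config V k)}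
    (hμ : HasMessageMarginals G Q x D Z μ) {Λ Δ : Finset V} (hΛ : Λ ⊆ Δ)
    (hN : ∀ u ∈ Λ, ∀ v, G.Adj u v → v ∈ Δ) (hΔ : (G.induce (Δ : Set V)).Connected)
    (ω : Config V k) :
    μ (agreeOn (Δ \ Λ) ω) = partitionFunction G Q Λ ω *
      ENNReal.ofReal (outerWeight G Q x Λ Δ ω / (Z * D ^ (Δ.card - 1))) := by
  rw [← tsum_measure_agreeOn_glue μ hΛ, partitionFunction, ← ENNReal.tsum_mul_right]
  refine tsum_congr fun ζ => ?_
  rw [hμ.measure_agreeOn h hΛ hN hΔ, outerWeight_glue]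

/-- If `Δ` contains `Λ` and all its neighbours, the kernel in `Λ` gives to a cylinder over `Δ`
a mass that only depends on whether the boundary condition agrees with it outside `Λ`. -/
theorem gibbsKernel_agreeOn [DecidableEq V] (G : SimpleGraph V) [G.LocallyFinite]
    (Q : TransferOperator k) {Λ Δ : Finset V} (hΛ : Λ ⊆ Δ)
    (hN : ∀ u ∈ Λ, ∀ v, G.Adj u v → v ∈ Δ) (η ω : Config V k) :
    gibbsKernel G Q Λ ω (agreeOn Δ η) = (agreeOn (Δ \ Λ) η).indicator
      (fun _ => (partitionFunction G Q Λ η)⁻¹ * volumeWeight G Q Λ η) ω := by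
  rw [gibbsKernel_apply G Q Λ ω (measurableSet_agreeOn Δ η)]
  by_cases hω : ω ∈ agreeOn (Δ \ Λ) η
  · have hvol : ∀ σ σ' : Config V k, (∀ v ∈ Δ, σ v = σ' v) →
        volumeWeight G Q Λ σ = volumeWeight G Q Λ σ' := by
      intro σ σ' hσ
      refine Finset.prod_congr rfl fun b hb => ?_
      rw [edgeWeight_congr Q fun v hv => hσ v ?_]
      obtain ⟨hb1, u, hu, hub⟩ := (mem_touchingEdges G Λ b).1 hb
      by_cases huv : v = u
      · exact huv ▸ hΛ hu
      · have : b = s(u, v) := (Sym2.mem_and_mem_iff (Ne.symm huv)).1 ⟨hub, hv⟩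
        rw [this] at hb1
        exact hN u hu v hb1
    have hglue : ∀ ζ : Λ → Lattice k, ∀ v ∈ Δ, glue Λ ζ ω v = glue Λ ζ η v := by
      intro ζ v hv
      by_cases hvΛ : v ∈ Λ
      · rw [glue_of_mem ζ _ hvΛ, glue_of_mem ζ _ hvΛ]
      · rw [glue_of_notMem ζ _ hvΛ, glue_of_notMem ζ _ hvΛ]
        exact hω v (Finset.mem_sdiff.2 ⟨hv, hvΛ⟩)
    have hself : glue Λ (fun v => η v) η = η := by
      funext v
      by_cases hvΛ : v ∈ Λ
      · rw [glue_of_mem _ _ hvΛ]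
      · rw [glue_of_notMem _ _ hvΛ]
    have hZ : partitionFunction G Q Λ ω = partitionFunction G Q Λ η :=
      tsum_congr fun ζ => hvol _ _ (hglue ζ)
    rw [Set.indicator_of_mem hω, hZ, tsum_eq_single fun v : Λ => η v]
    · have hmem : glue Λ (fun v => η v) ω ∈ agreeOn Δ η := by
        intro v hv
        rw [hglue _ v hv, hself]
      rw [Set.indicator_of_mem hmem, hvol _ _ (hglue _), hself, Pi.one_apply, mul_one]
    · intro ζ hζ
      rw [Set.indicator_of_notMem, mul_zero]
      intro hmem
      refine hζ (funext fun v => ?_)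
      rw [← hmem v (hΛ v.2), glue_of_mem ζ ω v.2]
  · rw [Set.indicator_of_notMem hω, ENNReal.tsum_eq_zero.2, mul_zero]
    intro ζ
    rw [Set.indicator_of_notMem, mul_zero]
    intro hmem
    refine hω fun v hv => ?_
    obtain ⟨h1, h2⟩ := Finset.mem_sdiff.1 hv
    rw [← hmem v h1, glue_of_notMem ζ ω h2]

/-- A probability measure with the marginals prescribed by a boundary law is a Gibbs measure. -/
theorem HasMessageMarginals.isGibbsMeasure {G : SimpleGraph V} [G.LocallyFinite]
    (hG : G.Connected) (h : IsBoundaryLaw d Q x D Z) {μ : Measure (Config V k)}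
    [IsProbabilityMeasure μ] (hμ : HasMessageMarginals G Q x D Z μ) : IsGibbsMeasure G Q μ := by
  classical
  have hc : ∀ Λ Δ ω, 0 < outerWeight G Q x Λ Δ ω / (Z * D ^ (Δ.card - 1)) := fun Λ Δ ω =>
    div_pos (outerWeight_pos G Q h.pos Λ Δ ω)
      (mul_pos h.normalization_pos (pow_pos h.eigenvalue_pos _))
  have hfin : ∀ (Λ : Finset V) (ω : Config V k), partitionFunction G Q Λ ω < ∞ := by
    intro Λ ω
    obtain ⟨Δ, -, hΛ, hN, hΔ⟩ := exists_connected_superset_neighbors hG ∅ Λ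
    have h1 := hμ.measure_agreeOn_sdiff h hΛ hN hΔ ω
    refine lt_top_iff_ne_top.2 fun htop => ?_
    rw [htop, ENNReal.top_mul (ENNReal.ofReal_pos.2 (hc Λ Δ ω)).ne'] at h1
    exact measure_ne_top _ _ h1
  refine ⟨fun Λ ω => ⟨partitionFunction_pos G Q Λ ω, hfin Λ ω⟩, inferInstance, ?_⟩
  intro Λ A hA
  suffices hbind : μ.bind (gibbsKernel G Q Λ) = μ by
    rw [← Measure.bind_apply hA (measurable_gibbsKernel G Q Λ).aemeasurable, hbind]
  refine ext_of_agreeOn fun S => ?_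
  obtain ⟨Δ, hS, hΛ, hN, hΔ⟩ := exists_connected_superset_neighbors hG S Λ
  refine ⟨Δ, hS, fun η => ?_⟩
  rw [Measure.bind_apply (measurableSet_agreeOn Δ η) (measurable_gibbsKernel G Q Λ).aemeasurable]
  simp only [gibbsKernel_agreeOn G Q hΛ hN η]
  rw [lintegral_indicator_const (measurableSet_agreeOn _ _),
    hμ.measure_agreeOn_sdiff h hΛ hN hΔ, hμ.measure_agreeOn h hΛ hN hΔ]
  have h1 := ENNReal.inv_mul_cancel (partitionFunction_pos G Q Λ η).ne' (hfin Λ η).ne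
  rw [mul_mul_mul_comm, h1, one_mul]

open Classical in
/-- The single-site marginals. -/
theorem HasMessageMarginals.measureReal_singleton {G : SimpleGraph V} [G.LocallyFinite]
    (hReg : G.IsRegularOfDegree (d + 1)) (h : IsBoundaryLaw d Q x D Z) {μ : Measure (Config V k)}
    (hμ : HasMessageMarginals G Q x D Z μ) (v : V) (i : Lattice k) :
    μ.real {ω | ω v = i} = x i ^ (d + 1) / Z := by
  have hconn : (G.induce (({v} : Finset V) : Set V)).Connected := by
    rw [Finset.coe_singleton]
    exact SimpleGraph.IsTree.of_subsingleton.connected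
  have h1 := hμ {v} hconn fun _ => i
  have h2 : agreeOn {v} (fun _ => i) = {ω : Config V k | ω v = i} := by
    ext σ
    simp [agreeOn]
  have h3 : innerEdges G {v} = ∅ := by
    rw [Finset.eq_empty_iff_forall_notMem]
    intro b hb
    obtain ⟨h4, h5⟩ := (mem_innerEdges G {v} b).1 hb
    induction b with
    | h u w =>
      have h6 := Finset.mem_singleton.1 (h5 u (by simp))
      have h7 := Finset.mem_singleton.1 (h5 w (by simp))
      rw [h6, h7] at h4
      exact G.loopless.irrefl v h4
  have h4 : outDegree G {v} v = d + 1 := by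
    rw [← hReg v, ← SimpleGraph.card_neighborFinset_eq_degree, outDegree,
      Finset.filter_true_of_mem]
    intro w hw
    rw [Finset.mem_singleton]
    rintro rfl
    simp at hw
  rw [h2, messageWeight, h3, Finset.prod_singleton, h4] at h1
  rw [Measure.real, h1, ENNReal.toReal_ofReal]
  · simp
  · have := h.normalization_pos
    have := h.pos i
    simp
    positivity

end

section

/-- Hölder's inequality for series, with weights `p + q = 1`. -/
theorem tsum_rpow_mul_rpow_le {α : Type*} (f g : α → ℝ≥0∞) {p q : ℝ} (hp : 0 ≤ p) (hq : 0 ≤ q)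
    (hpq : p + q = 1) : ∑' a, f a ^ p * g a ^ q ≤ (∑' a, f a) ^ p * (∑' a, g a) ^ q := by
  let _ : MeasurableSpace α := ⊤
  simpa only [lintegral_count] using ENNReal.lintegral_mul_norm_pow_le (μ := Measure.count)
    (measurable_from_top (f := f)).aemeasurable (measurable_from_top (f := g)).aemeasurable hp hq hpq

/-- Hölder's inequality for series with three factors. -/
theorem tsum_rpow_mul_rpow_mul_rpow_le {α : Type*} (f g h : α → ℝ≥0∞) {p q r : ℝ} (hp : 0 ≤ p)
    (hq : 0 ≤ q) (hr : 0 ≤ r) (hpqr : p + q + r = 1) :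
    ∑' a, f a ^ p * g a ^ q * h a ^ r ≤
      (∑' a, f a) ^ p * (∑' a, g a) ^ q * (∑' a, h a) ^ r := by
  let _ : MeasurableSpace α := ⊤
  have := ENNReal.lintegral_prod_norm_pow_le (μ := (Measure.count : Measure α)) Finset.univ
    (f := ![f, g, h]) (fun i _ => (measurable_from_top).aemeasurable) (p := ![p, q, r])
    (by simpa [Fin.sum_univ_three] using hpqr)
    (by intro i _; fin_cases i <;> simpa)
  simpa [Fin.prod_univ_three, lintegral_count] using this

/-- Minkowski's inequality for series. -/
theorem tsum_add_rpow_le {α : Type*} (f g : α → ℝ≥0∞) {p : ℝ} (hp : 1 ≤ p) :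
    (∑' a, (f a + g a) ^ p) ^ (1 / p) ≤ (∑' a, f a ^ p) ^ (1 / p) + (∑' a, g a ^ p) ^ (1 / p) := by
  let _ : MeasurableSpace α := ⊤
  simpa [lintegral_count] using ENNReal.lintegral_Lp_add_le (μ := Measure.count)
    (measurable_from_top (f := f)).aemeasurable (measurable_from_top (f := g)).aemeasurable hp

theorem pow_rpow_div {a : ℝ≥0∞} {m n : ℕ} : (a ^ (n + 1)) ^ ((m : ℝ) / ((n : ℝ) + 1)) = a ^ m := by
  rw [← ENNReal.rpow_natCast, ← ENNReal.rpow_mul, ← ENNReal.rpow_natCast a m]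
  congr 1
  push_cast
  field_simp

theorem le_of_le_pow_of_rpow {a b : ℝ≥0∞} {m n : ℕ} (h : a ≤ b ^ (n + 1)) :
    a ^ ((m : ℝ) / ((n : ℝ) + 1)) ≤ b ^ m := by
  rw [← pow_rpow_div (n := n)]
  exact ENNReal.rpow_le_rpow h (by positivity)

/-- Hölder's inequality for exponents `(d + 1) / 2` and `(d + 1) / (d - 1)`. -/
theorem tsum_mul_pow_pred_le {α : Type*} {d : ℕ} (hd : 1 ≤ d) (f g : α → ℝ≥0∞) {C E : ℝ≥0∞}
    (hf : (∑' a, f a ^ (((d : ℝ) + 1) / 2)) ^ (2 / ((d : ℝ) + 1)) ≤ C)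
    (hg : ∑' a, g a ^ (d + 1) ≤ E ^ (d + 1)) :
    ∑' a, f a * g a ^ (d - 1) ≤ C * E ^ (d - 1) := by
  have h1 := tsum_rpow_mul_rpow_le (fun a => f a ^ (((d : ℝ) + 1) / 2)) (fun a => g a ^ (d + 1))
    (p := 2 / ((d : ℝ) + 1)) (q := ((d - 1 : ℕ) : ℝ) / ((d : ℝ) + 1)) (by positivity)
    (by positivity) (by push_cast [Nat.cast_sub hd]; field_simp; ring)
  have h2 : ∀ a, (f a ^ (((d : ℝ) + 1) / 2)) ^ (2 / ((d : ℝ) + 1)) = f a := by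
    intro a
    rw [← ENNReal.rpow_mul, div_mul_div_cancel₀ (by positivity), div_self (by positivity : (d : ℝ) + 1 ≠ 0),
      ENNReal.rpow_one]
  simp only [h2, pow_rpow_div] at h1
  exact h1.trans (mul_le_mul' hf (le_of_le_pow_of_rpow hg))

/-- Hölder's inequality for exponents `d + 1` and `(d + 1) / d`. -/
theorem tsum_mul_pow_le {α : Type*} {d : ℕ} (f g : α → ℝ≥0∞) {C E : ℝ≥0∞}
    (hf : ∑' a, f a ^ (d + 1) ≤ C ^ (d + 1)) (hg : ∑' a, g a ^ (d + 1) ≤ E ^ (d + 1)) :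
    ∑' a, f a * g a ^ d ≤ C * E ^ d := by
  have h1 := tsum_rpow_mul_rpow_le (fun a => f a ^ (d + 1)) (fun a => g a ^ (d + 1))
    (p := ((1 : ℕ) : ℝ) / ((d : ℝ) + 1)) (q := (d : ℝ) / ((d : ℝ) + 1)) (by positivity)
    (by positivity) (by push_cast; field_simp; ring)
  simp only [pow_rpow_div, pow_one] at h1
  refine h1.trans (mul_le_mul' ?_ (le_of_le_pow_of_rpow hg))
  simpa only [pow_one] using le_of_le_pow_of_rpow (m := 1) hf

/-- Young's convolution inequality for exponents `(d + 1) / 2`, `(d + 1) / d` and `d + 1`. -/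
theorem tsum_convolution_pow_le {α : Type*} [AddCommGroup α] {d : ℕ} (hd : 1 ≤ d)
    (f g : α → ℝ≥0∞) {C E : ℝ≥0∞}
    (hf : (∑' a, f a ^ (((d : ℝ) + 1) / 2)) ^ (2 / ((d : ℝ) + 1)) ≤ C)
    (hg : ∑' a, g a ^ (d + 1) ≤ E ^ (d + 1)) :
    ∑' a, (∑' b, f (a - b) * g b ^ d) ^ (d + 1) ≤ (C * E ^ d) ^ (d + 1) := by
  set A := ∑' a, f a ^ (((d : ℝ) + 1) / 2) with hA
  set B := ∑' a, g a ^ (d + 1) with hB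
  have hAC : A ^ 2 ≤ C ^ (d + 1) := by
    calc A ^ 2 = (A ^ (2 / ((d : ℝ) + 1))) ^ (d + 1) := by
          rw [← ENNReal.rpow_natCast, ← ENNReal.rpow_natCast, ← ENNReal.rpow_mul]
          congr 1
          push_cast
          field_simp
      _ ≤ _ := by gcongr
  have hleft : ∀ a, ∑' b, f (a - b) ^ (((d : ℝ) + 1) / 2) = A := fun a =>
    (Equiv.subLeft a).tsum_eq fun b => f b ^ (((d : ℝ) + 1) / 2)
  have hright : ∀ b, ∑' a, f (a - b) ^ (((d : ℝ) + 1) / 2) = A := fun b =>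
    (Equiv.subRight b).tsum_eq fun a => f a ^ (((d : ℝ) + 1) / 2)
  have h1 : ∀ a, (∑' b, f (a - b) * g b ^ d) ^ (d + 1) ≤
      (∑' b, f (a - b) ^ (((d : ℝ) + 1) / 2) * g b ^ (d + 1)) * A * B ^ (d - 1) := by
    intro a
    have h2 := tsum_rpow_mul_rpow_mul_rpow_le
      (fun b => f (a - b) ^ (((d : ℝ) + 1) / 2) * g b ^ (d + 1))
      (fun b => f (a - b) ^ (((d : ℝ) + 1) / 2)) (fun b => g b ^ (d + 1))
      (p := ((1 : ℕ) : ℝ) / ((d : ℝ) + 1)) (q := ((1 : ℕ) : ℝ) / ((d : ℝ) + 1))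
      (r := ((d - 1 : ℕ) : ℝ) / ((d : ℝ) + 1))
      (by positivity) (by positivity) (by positivity)
      (by push_cast [Nat.cast_sub hd]; field_simp; ring)
    have h3 : ∀ b, (f (a - b) ^ (((d : ℝ) + 1) / 2) * g b ^ (d + 1)) ^
        (((1 : ℕ) : ℝ) / ((d : ℝ) + 1)) *
        (f (a - b) ^ (((d : ℝ) + 1) / 2)) ^ (((1 : ℕ) : ℝ) / ((d : ℝ) + 1)) *
        (g b ^ (d + 1)) ^ (((d - 1 : ℕ) : ℝ) / ((d : ℝ) + 1)) = f (a - b) * g b ^ d := by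
      intro b
      rw [ENNReal.mul_rpow_of_nonneg _ _ (by positivity), pow_rpow_div, pow_rpow_div, pow_one,
        ← ENNReal.rpow_mul]
      have h4 : ((d : ℝ) + 1) / 2 * (((1 : ℕ) : ℝ) / ((d : ℝ) + 1)) = 1 / 2 := by
        push_cast
        field_simp
      have h5 : f (a - b) ^ (1 / 2 : ℝ) * f (a - b) ^ (1 / 2 : ℝ) = f (a - b) := by
        rw [← ENNReal.rpow_add_of_nonneg _ _ (by positivity) (by positivity)]
        norm_num
      have h6 : g b * g b ^ (d - 1) = g b ^ d := by
        rw [← pow_succ', Nat.sub_add_cancel hd]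
      rw [h4]
      calc _ = (f (a - b) ^ (1 / 2 : ℝ) * f (a - b) ^ (1 / 2 : ℝ)) * (g b * g b ^ (d - 1)) := by
            ring
        _ = _ := by rw [h5, h6]
    simp only [h3] at h2
    rw [hleft a] at h2
    refine (pow_le_pow_left' h2 (d + 1)).trans_eq ?_
    have h7 : ∀ (z : ℝ≥0∞) (m : ℕ), (z ^ ((m : ℝ) / ((d : ℝ) + 1))) ^ (d + 1) = z ^ m := by
      intro z m
      rw [← ENNReal.rpow_natCast, ← ENNReal.rpow_mul, ← ENNReal.rpow_natCast]
      congr 1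
      push_cast
      field_simp
    rw [mul_pow, mul_pow, h7, h7, h7, pow_one, pow_one]
  calc ∑' a, (∑' b, f (a - b) * g b ^ d) ^ (d + 1)
      ≤ ∑' a, (∑' b, f (a - b) ^ (((d : ℝ) + 1) / 2) * g b ^ (d + 1)) * A * B ^ (d - 1) :=
        ENNReal.tsum_le_tsum h1
    _ = A ^ 2 * B ^ d := by
        rw [ENNReal.tsum_mul_right, ENNReal.tsum_mul_right, ENNReal.tsum_comm]
        simp only [ENNReal.tsum_mul_right, hright, ENNReal.tsum_mul_left]
        rw [← hB]
        calc _ = A ^ 2 * (B * B ^ (d - 1)) := by ring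
          _ = _ := by rw [← pow_succ', Nat.sub_add_cancel hd]
    _ ≤ C ^ (d + 1) * (E ^ (d + 1)) ^ d := by gcongr
    _ = _ := by ring

/-- Minkowski's inequality with natural powers. -/
theorem tsum_add_pow_le {α : Type*} {n : ℕ} (f g : α → ℝ≥0∞) {C E : ℝ≥0∞}
    (hf : ∑' a, f a ^ (n + 1) ≤ C ^ (n + 1)) (hg : ∑' a, g a ^ (n + 1) ≤ E ^ (n + 1)) :
    ∑' a, (f a + g a) ^ (n + 1) ≤ (C + E) ^ (n + 1) := by
  have h1 := tsum_add_rpow_le f g (p := (n : ℝ) + 1) (by simp)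
  have h0 : ∀ a : ℝ≥0∞, a ^ ((n : ℝ) + 1) = a ^ (n + 1) := by
    intro a
    rw [← ENNReal.rpow_natCast]
    push_cast
    rfl
  simp only [h0] at h1
  have h2 : ∀ {a b : ℝ≥0∞}, a ≤ b ^ (n + 1) → a ^ (1 / ((n : ℝ) + 1)) ≤ b := by
    intro a b hab
    simpa using le_of_le_pow_of_rpow (m := 1) hab
  have h3 := h1.trans (add_le_add (h2 hf) (h2 hg))
  have h4 := pow_le_pow_left' h3 (n + 1)
  rwa [← h0, ← ENNReal.rpow_mul, one_div_mul_cancel (by positivity), ENNReal.rpow_one] at h4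

end

section

theorem summable_and_tsum_le_of_ofReal {α : Type*} {f : α → ℝ} (hf : ∀ a, 0 ≤ f a) {C : ℝ}
    (hC : 0 ≤ C) (h : ∑' a, ENNReal.ofReal (f a) ≤ ENNReal.ofReal C) :
    Summable f ∧ ∑' a, f a ≤ C := by
  have hs : Summable f := by
    have h1 := ENNReal.summable_toReal (ne_top_of_le_ne_top ENNReal.ofReal_ne_top h)
    simpa only [ENNReal.toReal_ofReal (hf _)] using h1
  refine ⟨hs, ?_⟩
  rw [← ENNReal.ofReal_tsum_of_nonneg hf hs] at h
  exact (ENNReal.ofReal_le_ofReal_iff hC).1 h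

theorem abs_pow_sub_pow_le {a b : ℝ} (ha : 0 ≤ a) (hb : 0 ≤ b) {d : ℕ} (hd : 1 ≤ d) :
    |a ^ d - b ^ d| ≤ d / 2 * |a - b| * (a ^ (d - 1) + b ^ (d - 1)) := by
  have h1 := (Commute.all a b).mul_geom_sum₂ d
  have h2 : 2 * ∑ i ∈ Finset.range d, a ^ i * b ^ (d - 1 - i) ≤
      d * (a ^ (d - 1) + b ^ (d - 1)) := by
    have h3 : ∑ i ∈ Finset.range d, a ^ i * b ^ (d - 1 - i) =
        ∑ i ∈ Finset.range d, a ^ (d - 1 - i) * b ^ i := by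
      rw [← Finset.sum_range_reflect]
      refine Finset.sum_congr rfl fun i hi => ?_
      have := Finset.mem_range.1 hi
      congr 2
      omega
    calc 2 * ∑ i ∈ Finset.range d, a ^ i * b ^ (d - 1 - i)
        = ∑ i ∈ Finset.range d, (a ^ i * b ^ (d - 1 - i) + a ^ (d - 1 - i) * b ^ i) := by
          rw [Finset.sum_add_distrib, ← h3, two_mul]
      _ ≤ ∑ i ∈ Finset.range d, (a ^ (d - 1) + b ^ (d - 1)) := by
          refine Finset.sum_le_sum fun i hi => ?_
          have hi' := Finset.mem_range.1 hi
          have h4 : ∀ c : ℝ, c ^ (d - 1) = c ^ i * c ^ (d - 1 - i) := fun c => by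
            rw [← pow_add]
            congr 1
            omega
          have h5 : 0 ≤ (a ^ i - b ^ i) * (a ^ (d - 1 - i) - b ^ (d - 1 - i)) := by
            rcases le_total a b with h | h
            · exact mul_nonneg_of_nonpos_of_nonpos
                (sub_nonpos.2 (pow_le_pow_left₀ ha h _)) (sub_nonpos.2 (pow_le_pow_left₀ ha h _))
            · exact mul_nonneg
                (sub_nonneg.2 (pow_le_pow_left₀ hb h _)) (sub_nonneg.2 (pow_le_pow_left₀ hb h _))
          rw [h4 a, h4 b]
          linarith
      _ = _ := by simp [mul_add]
  have h6 : 0 ≤ ∑ i ∈ Finset.range d, a ^ i * b ^ (d - 1 - i) :=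
    Finset.sum_nonneg fun i _ => mul_nonneg (pow_nonneg ha _) (pow_nonneg hb _)
  rw [← h1, abs_mul, abs_of_nonneg h6]
  nlinarith [abs_nonneg (a - b)]

variable {k : ℕ}

/-- The nonnegative functions on the lattice that vanish at the origin and whose
`(d + 1)`-norm is at most `E`. -/
structure InBall (d : ℕ) (E : ℝ) (y : Lattice k → ℝ) : Prop where
  nonneg : ∀ j, 0 ≤ y j
  zero : y 0 = 0
  norm_le : ∑' j, ENNReal.ofReal (y j) ^ (d + 1) ≤ ENNReal.ofReal E ^ (d + 1)

theorem InBall.le {d : ℕ} {E : ℝ} {y : Lattice k → ℝ} (hE : 0 ≤ E) (h : InBall d E y)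
    (j : Lattice k) : y j ≤ E := by
  have h1 := (ENNReal.le_tsum j).trans h.norm_le
  exact (ENNReal.ofReal_le_ofReal_iff hE).1 ((ENNReal.pow_le_pow_left_iff (by simp)).1 h1)

/-- The norms of `Q` are `γ` and `δ`, in the form used by the convolution inequalities. -/
structure HasNorms (d : ℕ) (Q : TransferOperator k) (γ δ : ℝ) : Prop where
  one_le : 1 ≤ d
  at_zero : Q 0 = 1
  gamma_nonneg : 0 ≤ γ
  delta_nonneg : 0 ≤ δ
  gamma_eq : (∑' j, ENNReal.ofReal (Q j) ^ (((d : ℝ) + 1) / 2)) ^ (2 / ((d : ℝ) + 1)) =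
    ENNReal.ofReal γ
  delta_eq : ∑' j, (if j = 0 then 0 else ENNReal.ofReal (Q j)) ^ (d + 1) =
    ENNReal.ofReal δ ^ (d + 1)

/-- The convolution of `Q` with the `d`-th power of `y`. -/
def conv (d : ℕ) (Q : TransferOperator k) (y : Lattice k → ℝ) (i : Lattice k) : ℝ :=
  ∑' j, Q (i - j) * y j ^ d

/-- The map whose fixed points are the `d`-th roots of the boundary laws, normalized to be `1`
at the origin and with the value at the origin removed. -/
def lawMap (d : ℕ) (Q : TransferOperator k) (y : Lattice k → ℝ) (i : Lattice k) : ℝ :=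
  if i = 0 then 0 else (Q i + conv d Q y i) / (1 + conv d Q y 0)

namespace HasNorms

variable {d : ℕ} {Q : TransferOperator k} {γ δ E : ℝ} {y z : Lattice k → ℝ}

theorem conv_nonneg (Q : TransferOperator k) (hy : InBall d E y) (i : Lattice k) :
    0 ≤ conv d Q y i :=
  tsum_nonneg fun _ => mul_nonneg (Q.pos _).le (pow_nonneg (hy.nonneg _) _)

theorem tsum_ofReal_conv_le (h : HasNorms d Q γ δ) (hE : 0 ≤ E) (hy : InBall d E y) :
    ∑' i, (∑' j, ENNReal.ofReal (Q (i - j) * y j ^ d)) ^ (d + 1) ≤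
      ENNReal.ofReal (γ * E ^ d) ^ (d + 1) := by
  have h1 := tsum_convolution_pow_le h.one_le (fun j => ENNReal.ofReal (Q j))
    (fun j => ENNReal.ofReal (y j)) h.gamma_eq.le hy.norm_le
  rw [ENNReal.ofReal_mul h.gamma_nonneg, ENNReal.ofReal_pow hE]
  refine le_trans (le_of_eq ?_) h1
  simp only [ENNReal.ofReal_mul (Q.pos _).le, ENNReal.ofReal_pow (hy.nonneg _)]

theorem summable_conv (h : HasNorms d Q γ δ) (hE : 0 ≤ E) (hy : InBall d E y) (i : Lattice k) :
    Summable fun j => Q (i - j) * y j ^ d := by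
  have h1 := (ENNReal.le_tsum i).trans (h.tsum_ofReal_conv_le hE hy)
  have h2 := (ENNReal.pow_le_pow_left_iff (by simp)).1 h1
  exact (summable_and_tsum_le_of_ofReal
    (fun j => mul_nonneg (Q.pos _).le (pow_nonneg (hy.nonneg _) _))
    (mul_nonneg h.gamma_nonneg (pow_nonneg hE _)) h2).1

theorem tsum_ofReal_conv_pow_le (h : HasNorms d Q γ δ) (hE : 0 ≤ E) (hy : InBall d E y) :
    ∑' i, ENNReal.ofReal (conv d Q y i) ^ (d + 1) ≤ ENNReal.ofReal (γ * E ^ d) ^ (d + 1) := by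
  refine le_trans (le_of_eq ?_) (h.tsum_ofReal_conv_le hE hy)
  refine tsum_congr fun i => ?_
  rw [conv, ENNReal.ofReal_tsum_of_nonneg
    (fun j => mul_nonneg (Q.pos _).le (pow_nonneg (hy.nonneg _) _)) (h.summable_conv hE hy i)]

theorem inBall_lawMap (h : HasNorms d Q γ δ) (hE : 0 ≤ E) (hy : InBall d E y) :
    InBall d (δ + γ * E ^ d) (lawMap d Q y) where
  nonneg i := by
    rw [lawMap]
    split_ifs
    · exact le_rfl
    · exact div_nonneg (add_nonneg (Q.pos _).le (conv_nonneg Q hy i))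
        (add_nonneg zero_le_one (conv_nonneg Q hy 0))
  zero := if_pos rfl
  norm_le := by
    have h1 := tsum_add_pow_le _ _ h.delta_eq.le (h.tsum_ofReal_conv_pow_le hE hy)
    rw [← ENNReal.ofReal_add h.delta_nonneg (mul_nonneg h.gamma_nonneg (pow_nonneg hE _))] at h1
    refine le_trans (ENNReal.tsum_le_tsum fun i => pow_le_pow_left' ?_ _) h1
    rw [lawMap]
    split_ifs with hi
    · simp
    · rw [← ENNReal.ofReal_add (Q.pos _).le (conv_nonneg Q hy i)]
      refine ENNReal.ofReal_le_ofReal (div_le_self ?_ ?_)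
      · exact add_nonneg (Q.pos _).le (conv_nonneg Q hy i)
      · linarith [conv_nonneg Q hy 0]

theorem conv_zero_le (h : HasNorms d Q γ δ) (hE : 0 ≤ E) (hy : InBall d E y) :
    conv d Q y 0 ≤ δ * E ^ d := by
  have h1 := tsum_mul_pow_le _ _ h.delta_eq.le hy.norm_le
  refine (summable_and_tsum_le_of_ofReal
    (fun j => mul_nonneg (Q.pos _).le (pow_nonneg (hy.nonneg _) _))
    (mul_nonneg h.delta_nonneg (pow_nonneg hE _)) ?_).2
  rw [ENNReal.ofReal_mul h.delta_nonneg, ENNReal.ofReal_pow hE]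
  refine le_trans (le_of_eq (tsum_congr fun j => ?_)) h1
  split_ifs with hj
  · have := h.one_le
    simp [hj, hy.zero, show d ≠ 0 by omega]
  · rw [zero_sub, Q.symm, ENNReal.ofReal_mul (Q.pos _).le, ENNReal.ofReal_pow (hy.nonneg _)]

theorem summable_and_tsum_mul_pow_pred_le (h : HasNorms d Q γ δ) (hE : 0 ≤ E)
    (hy : InBall d E y) (i : Lattice k) :
    Summable (fun j => Q (i - j) * y j ^ (d - 1)) ∧
      ∑' j, Q (i - j) * y j ^ (d - 1) ≤ γ * E ^ (d - 1) := by
  refine summable_and_tsum_le_of_ofReal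
    (fun j => mul_nonneg (Q.pos _).le (pow_nonneg (hy.nonneg _) _))
    (mul_nonneg h.gamma_nonneg (pow_nonneg hE _)) ?_
  have h1 : (∑' j, ENNReal.ofReal (Q (i - j)) ^ (((d : ℝ) + 1) / 2)) ^ (2 / ((d : ℝ) + 1)) ≤
      ENNReal.ofReal γ := by
    have h0 := (Equiv.subLeft i).tsum_eq fun j => ENNReal.ofReal (Q j) ^ (((d : ℝ) + 1) / 2)
    rw [← h.gamma_eq, ← h0]
    rfl
  have h2 := tsum_mul_pow_pred_le h.one_le _ _ h1 hy.norm_le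
  rw [ENNReal.ofReal_mul h.gamma_nonneg, ENNReal.ofReal_pow hE]
  refine le_trans (le_of_eq (tsum_congr fun j => ?_)) h2
  rw [ENNReal.ofReal_mul (Q.pos _).le, ENNReal.ofReal_pow (hy.nonneg _)]

theorem abs_conv_sub_conv_le (h : HasNorms d Q γ δ) (hE : 0 ≤ E) (hy : InBall d E y)
    (hz : InBall d E z) {s : ℝ} (hs : ∀ j, |y j - z j| ≤ s) (i : Lattice k) :
    |conv d Q y i - conv d Q z i| ≤ d * γ * E ^ (d - 1) * s := by
  have h1 := h.summable_and_tsum_mul_pow_pred_le hE hy i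
  have h2 := h.summable_and_tsum_mul_pow_pred_le hE hz i
  have hs0 : 0 ≤ s := (abs_nonneg _).trans (hs 0)
  rw [conv, conv, ← (h.summable_conv hE hy i).tsum_sub (h.summable_conv hE hz i),
    ← Real.norm_eq_abs]
  have h3 := (h1.1.hasSum.add h2.1.hasSum).mul_left (d / 2 * s)
  refine (tsum_of_norm_bounded h3 fun j => ?_).trans ?_
  · rw [← mul_sub, Real.norm_eq_abs, abs_mul, abs_of_pos (Q.pos _), ← mul_add,
      mul_left_comm (d / 2 * s)]
    refine mul_le_mul_of_nonneg_left ?_ (Q.pos _).le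
    refine (abs_pow_sub_pow_le (hy.nonneg j) (hz.nonneg j) h.one_le).trans ?_
    have := add_nonneg (pow_nonneg (hy.nonneg j) (d - 1)) (pow_nonneg (hz.nonneg j) (d - 1))
    have := hs j
    gcongr
  · calc d / 2 * s * (_ + _) ≤ d / 2 * s * (γ * E ^ (d - 1) + γ * E ^ (d - 1)) := by
          gcongr
          exacts [h1.2, h2.2]
      _ = _ := by ring

theorem abs_lawMap_sub_lawMap_le (h : HasNorms d Q γ δ) (hE : 0 ≤ E)
    (hδE : δ + γ * E ^ d ≤ E) (hy : InBall d E y)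
    (hz : InBall d E z) {s : ℝ} (hs : ∀ j, |y j - z j| ≤ s) (i : Lattice k) :
    |lawMap d Q y i - lawMap d Q z i| ≤ d * γ * E ^ (d - 1) * (1 + E) * s := by
  have hs0 : 0 ≤ s := (abs_nonneg _).trans (hs 0)
  have hK : 0 ≤ d * γ * E ^ (d - 1) * s :=
    (abs_nonneg _).trans (h.abs_conv_sub_conv_le hE hy hz hs 0)
  by_cases hi : i = 0
  · rw [lawMap, lawMap, if_pos hi, if_pos hi, sub_self, abs_zero]
    nlinarith
  · have hzi : |lawMap d Q z i| ≤ E := by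
      have h1 := h.inBall_lawMap hE hz
      rw [abs_of_nonneg (h1.nonneg i)]
      refine (h1.le ?_ i).trans hδE
      exact add_nonneg h.delta_nonneg (mul_nonneg h.gamma_nonneg (pow_nonneg hE _))
    have hDy := conv_nonneg Q hy 0
    have hDz := conv_nonneg Q hz 0
    have h1 : lawMap d Q y i - lawMap d Q z i =
        ((conv d Q y i - conv d Q z i) - lawMap d Q z i * (conv d Q y 0 - conv d Q z 0)) /
          (1 + conv d Q y 0) := by
      rw [lawMap, lawMap, if_neg hi, if_neg hi]
      field_simp
      ring
    rw [h1, abs_div, abs_of_pos (by linarith : 0 < 1 + conv d Q y 0)]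
    refine (div_le_self (abs_nonneg _) (by linarith)).trans ?_
    refine (abs_sub _ _).trans ?_
    rw [abs_mul]
    have h2 := h.abs_conv_sub_conv_le hE hy hz hs i
    have h3 := h.abs_conv_sub_conv_le hE hy hz hs 0
    have h4 := mul_le_mul hzi h3 (abs_nonneg _) hE
    linarith

/-- The map `lawMap` has a fixed point in the ball of radius `E`, since it is a contraction of it
for the supremum norm. -/
theorem exists_fixedPoint (h : HasNorms d Q γ δ) (hE : 0 ≤ E)
    (hδE : δ + γ * E ^ d ≤ E) (hc : d * γ * E ^ (d - 1) * (1 + E) < 1) :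
    ∃ y : Lattice k → ℝ, InBall d E y ∧ lawMap d Q y = y := by
  set c := d * γ * E ^ (d - 1) * (1 + E) with hcdef
  have hc0 : 0 ≤ c := by
    have := h.gamma_nonneg
    positivity
  let u : ℕ → Lattice k → ℝ := fun n => (lawMap d Q)^[n] 0
  have hu : ∀ n, u (n + 1) = lawMap d Q (u n) := fun n => Function.iterate_succ_apply' _ _ _
  have hball : ∀ n, InBall d E (u n) := by
    intro n
    induction n with
    | zero => exact ⟨fun _ => le_rfl, rfl, by simp [u]⟩
    | succ n ih =>
      rw [hu]
      have h1 := h.inBall_lawMap hE ih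
      exact ⟨h1.nonneg, h1.zero, h1.norm_le.trans (by gcongr)⟩
  have hdist : ∀ n j, |u (n + 1) j - u n j| ≤ E * c ^ n := by
    intro n
    induction n with
    | zero =>
      intro j
      have h1 : u 0 j = 0 := rfl
      rw [h1, sub_zero, abs_of_nonneg ((hball 1).nonneg j), pow_zero, mul_one]
      exact (hball 1).le hE j
    | succ n ih =>
      intro j
      rw [hu (n + 1), hu n]
      have := h.abs_lawMap_sub_lawMap_le hE hδE (hball (n + 1)) (hball n) ih j
      rw [hu n] at this
      refine this.trans_eq ?_
      rw [pow_succ]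
      ring
  have hdist' : ∀ j n, dist (u n j) (u (n + 1) j) ≤ E * c ^ n := fun j n => by
    rw [dist_comm, Real.dist_eq]
    exact hdist n j
  choose y hy using fun j => cauchySeq_tendsto_of_complete
    (cauchySeq_of_le_geometric c E hc (hdist' j))
  have hlim : ∀ n j, |y j - u n j| ≤ E * c ^ n / (1 - c) := fun n j => by
    rw [abs_sub_comm, ← Real.dist_eq]
    exact dist_le_of_le_geometric_of_tendsto c E hc (hdist' j) (hy j) n
  have hyball : InBall d E y := by
    refine ⟨fun j => ge_of_tendsto' (hy j) fun n => (hball n).nonneg j, ?_, ?_⟩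
    · refine tendsto_nhds_unique (hy 0) ?_
      simp only [(hball _).zero]
      exact tendsto_const_nhds
    · rw [ENNReal.tsum_eq_iSup_sum]
      refine iSup_le fun s => ?_
      refine le_of_tendsto' (x := Filter.atTop)
        (f := fun n => ∑ j ∈ s, ENNReal.ofReal (u n j) ^ (d + 1)) ?_ fun n =>
        (ENNReal.sum_le_tsum s).trans (hball n).norm_le
      exact tendsto_finsetSum _ fun j _ =>
        ((ENNReal.continuous_pow (d + 1)).tendsto _).comp (ENNReal.tendsto_ofReal (hy j))
  refine ⟨y, hyball, funext fun j => ?_⟩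
  have h1 : Filter.Tendsto (fun n => u (n + 1) j) Filter.atTop (nhds (lawMap d Q y j)) := by
    rw [tendsto_iff_dist_tendsto_zero]
    have h2 : Filter.Tendsto (fun n : ℕ => c * (E * c ^ n / (1 - c))) Filter.atTop (nhds 0) := by
      have h3 := tendsto_pow_atTop_nhds_zero_of_lt_one hc0 hc
      simpa using ((h3.const_mul E).div_const (1 - c)).const_mul c
    refine squeeze_zero (fun _ => dist_nonneg) (fun n => ?_) h2
    rw [dist_comm, Real.dist_eq, hu]
    exact h.abs_lawMap_sub_lawMap_le hE hδE hyball (hball n) (hlim n) j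
  exact tendsto_nhds_unique h1 ((Filter.tendsto_add_atTop_iff_nat 1).2 (hy j))

end HasNorms

end

section

variable {k d : ℕ} {Q : TransferOperator k} {γ δ E : ℝ} {y : Lattice k → ℝ}

theorem hasNorms_of_pNorm (hd : 1 ≤ d) (hQ0 : Q 0 = 1) (hγ0 : 0 ≤ γ) (hδ0 : 0 ≤ δ)
    (hγ : pNorm (((d : ℝ) + 1) / 2) Set.univ Q = ENNReal.ofReal γ)
    (hδ : pNorm ((d : ℝ) + 1) {0}ᶜ Q = ENNReal.ofReal δ) : HasNorms d Q γ δ where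
  one_le := hd
  at_zero := hQ0
  gamma_nonneg := hγ0
  delta_nonneg := hδ0
  gamma_eq := by
    rw [← hγ, pNorm, tsum_univ fun j => ENNReal.ofReal (|Q j| ^ (((d : ℝ) + 1) / 2)), one_div_div]
    congr 1
    refine tsum_congr fun j => ?_
    rw [abs_of_pos (Q.pos j), ENNReal.ofReal_rpow_of_pos (Q.pos j)]
  delta_eq := by
    rw [← hδ, pNorm, ← ENNReal.rpow_natCast (n := d + 1), ← ENNReal.rpow_mul]
    rw [show 1 / ((d : ℝ) + 1) * ((d + 1 : ℕ) : ℝ) = 1 by push_cast; field_simp, ENNReal.rpow_one,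
      tsum_subtype ({0}ᶜ : Set (Lattice k)) fun j => ENNReal.ofReal (|Q j| ^ ((d : ℝ) + 1))]
    refine tsum_congr fun j => ?_
    by_cases hj : j = 0
    · simp [hj]
    · have h1 : j ∈ ({0}ᶜ : Set (Lattice k)) := hj
      rw [Set.indicator_of_mem h1, if_neg hj, abs_of_pos (Q.pos j),
        ← ENNReal.ofReal_pow (Q.pos j).le]
      congr 1
      exact_mod_cast (Real.rpow_natCast (Q j) (d + 1)).symm

theorem InBall.summable_pow (hE : 0 ≤ E) (hy : InBall d E y) :
    Summable (fun j => y j ^ (d + 1)) := by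
  refine (summable_and_tsum_le_of_ofReal (fun j => pow_nonneg (hy.nonneg j) _)
    (pow_nonneg hE (d + 1)) ?_).1
  simpa only [ENNReal.ofReal_pow hE, ENNReal.ofReal_pow (hy.nonneg _)] using hy.norm_le

theorem InBall.tsum_pow_le (hE : 0 ≤ E) (hy : InBall d E y) :
    ∑' j, y j ^ (d + 1) ≤ E ^ (d + 1) := by
  refine (summable_and_tsum_le_of_ofReal (fun j => pow_nonneg (hy.nonneg j) _)
    (pow_nonneg hE (d + 1)) ?_).2
  simpa only [ENNReal.ofReal_pow hE, ENNReal.ofReal_pow (hy.nonneg _)] using hy.norm_le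

/-- The boundary law attached to a fixed point of `lawMap`. -/
def lawOfFixedPoint (y : Lattice k → ℝ) (j : Lattice k) : ℝ :=
  if j = 0 then 1 else y j

theorem hasSum_lawOfFixedPoint {f : Lattice k → ℝ} {n : ℕ} (hn : n ≠ 0) (hy0 : y 0 = 0) {s : ℝ}
    (hs : HasSum (fun j => f j * y j ^ n) s) :
    HasSum (fun j => f j * lawOfFixedPoint y j ^ n) (f 0 + s) := by
  refine ((hasSum_ite_eq (0 : Lattice k) (f 0)).add hs).congr_fun ?_
  intro j
  by_cases hj : j = 0
  · simp [hj, lawOfFixedPoint, hy0, hn]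
  · simp [hj, lawOfFixedPoint]

theorem HasNorms.isBoundaryLaw (h : HasNorms d Q γ δ) (hE : 0 ≤ E) (hy : InBall d E y)
    (hfix : lawMap d Q y = y) :
    IsBoundaryLaw d Q (lawOfFixedPoint y) (1 + conv d Q y 0) (1 + ∑' j, y j ^ (d + 1)) := by
  have hD : 0 < 1 + conv d Q y 0 := by linarith [HasNorms.conv_nonneg Q hy 0]
  refine ⟨fun j => ?_, fun a => ?_, ?_⟩
  · rw [lawOfFixedPoint]
    split_ifs with hj
    · exact one_pos
    · rw [← hfix, lawMap, if_neg hj]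
      exact div_pos (add_pos_of_pos_of_nonneg (Q.pos _) (HasNorms.conv_nonneg Q hy j)) hD
  · have h1 := hasSum_lawOfFixedPoint (f := fun j => Q (a - j))
      (by have := h.one_le; omega : d ≠ 0) hy.zero (h.summable_conv hE hy a).hasSum
    convert h1 using 1
    rw [sub_zero, lawOfFixedPoint]
    split_ifs with ha
    · rw [ha, h.at_zero, mul_one, conv]
    · have h2 := congrFun hfix a
      rw [lawMap, if_neg ha, div_eq_iff hD.ne'] at h2
      rw [mul_comm, ← h2, conv]
  · have h1 := hasSum_lawOfFixedPoint (f := fun _ => 1) (n := d + 1) (by simp) hy.zero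
      (by simpa using (hy.summable_pow hE).hasSum)
    simpa using h1

/-- A fixed point of `lawMap` satisfies the same a priori bound as the elements of the ball, with
its own norm as radius. -/
theorem HasNorms.norm_bounds (h : HasNorms d Q γ δ) (hE : 0 ≤ E) (hy : InBall d E y)
    (hfix : lawMap d Q y = y) {b : ℝ} (hb : 0 ≤ b) (hbE : ∑' j, y j ^ (d + 1) = b ^ (d + 1)) :
    b ≤ E ∧ b ≤ δ + γ * b ^ d ∧ δ ≤ (1 + δ * E ^ d) * b := by
  have htsum : ∑' j, ENNReal.ofReal (y j) ^ (d + 1) = ENNReal.ofReal b ^ (d + 1) := by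
    rw [← ENNReal.ofReal_pow hb, ← hbE, ENNReal.ofReal_tsum_of_nonneg
      (fun j => pow_nonneg (hy.nonneg j) _) (hy.summable_pow hE)]
    simp only [ENNReal.ofReal_pow (hy.nonneg _)]
  have hyb : InBall d b y := ⟨hy.nonneg, hy.zero, htsum.le⟩
  have hrad : 0 ≤ δ + γ * b ^ d :=
    add_nonneg h.delta_nonneg (mul_nonneg h.gamma_nonneg (pow_nonneg hb _))
  refine ⟨?_, ?_, ?_⟩
  · refine (pow_le_pow_iff_left₀ hb hE (Nat.succ_ne_zero d)).1 ?_
    exact hbE ▸ hy.tsum_pow_le hE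
  · have h1 := h.inBall_lawMap hb hyb
    rw [hfix] at h1
    refine (pow_le_pow_iff_left₀ hb hrad (Nat.succ_ne_zero d)).1 ?_
    exact hbE ▸ h1.tsum_pow_le hrad
  · set D := 1 + conv d Q y 0 with hDdef
    have hD : 0 < D := by linarith [HasNorms.conv_nonneg Q hy 0]
    have h1 : ENNReal.ofReal δ ^ (d + 1) ≤ ENNReal.ofReal (D * b) ^ (d + 1) := by
      rw [← h.delta_eq, ENNReal.ofReal_mul hD.le, mul_pow, ← htsum, ← ENNReal.tsum_mul_left]
      refine ENNReal.tsum_le_tsum fun j => ?_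
      rw [← mul_pow, ← ENNReal.ofReal_mul hD.le]
      refine pow_le_pow_left' ?_ _
      split_ifs with hj
      · exact zero_le
      · refine ENNReal.ofReal_le_ofReal ?_
        have h2 := congrFun hfix j
        rw [lawMap, if_neg hj, div_eq_iff hD.ne'] at h2
        linarith [HasNorms.conv_nonneg Q hy j]
    have h2 := (ENNReal.ofReal_le_ofReal_iff (mul_nonneg hD.le hb)).1
      ((ENNReal.pow_le_pow_left_iff (by simp)).1 h1)
    refine h2.trans (mul_le_mul_of_nonneg_right ?_ hb)
    linarith [h.conv_zero_le hE hy]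

theorem exists_isLeast_of_mem_goodSet (hd : 2 ≤ d) (hGood : (γ, δ) ∈ goodSet d) :
    ∃ ε : ℝ, IsLeast {t : ℝ | 0 < t ∧ t = γ * t ^ d + δ} ε ∧
      2 * d * γ * ε ^ (d - 1) + 2 * d * δ * ε ^ d < 1 := by
  obtain ⟨hγ, hδ, ε₀, hε₀, h1, h2⟩ := hGood
  dsimp only at hγ hδ h1 h2
  have hcont : Continuous fun t : ℝ => γ * t ^ d + δ - t := by fun_prop
  have hd0 : d ≠ 0 := by omega
  have hroot : ∃ t ∈ Set.Icc 0 ε₀, γ * t ^ d + δ - t = 0 := by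
    refine intermediate_value_Icc' hε₀.le hcont.continuousOn ⟨?_, ?_⟩
    · linarith
    · simp [hd0, hδ.le]
  have hclosed : IsClosed {t : ℝ | γ * t ^ d + δ - t = 0} := isClosed_eq hcont continuous_const
  obtain ⟨ε, ⟨⟨hε0, hεε₀⟩, hε⟩, hmin⟩ :=
    (isCompact_Icc.inter_right hclosed).exists_isLeast
      (let ⟨t, ht, ht'⟩ := hroot; ⟨t, ht, ht'⟩ :
        (Set.Icc 0 ε₀ ∩ {t : ℝ | γ * t ^ d + δ - t = 0}).Nonempty)
  change γ * ε ^ d + δ - ε = 0 at hε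
  have hpos : 0 < ε := by
    have : 0 ≤ γ * ε ^ d := by positivity
    linarith
  refine ⟨ε, ⟨⟨hpos, by linarith⟩, fun t ⟨ht0, ht⟩ => ?_⟩, ?_⟩
  · rcases le_total t ε₀ with h | h
    · exact hmin ⟨⟨ht0.le, h⟩, by change γ * t ^ d + δ - t = 0; linarith⟩
    · exact hεε₀.trans h
  · refine lt_of_le_of_lt ?_ h2
    have := hpos.le
    gcongr

theorem localization_bounds (hd : 1 ≤ d) {ε b : ℝ} (hγ : 0 ≤ γ) (hδ : 0 ≤ δ) (hε : 0 ≤ ε)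
    (hγε : γ * ε ^ (d - 1) < 1) (hδε : δ * ε ^ d ≤ 1) (hb : 0 ≤ b) (hbε : b ≤ ε)
    (hup : b ≤ δ + γ * b ^ d) (hlow : δ ≤ (1 + δ * ε ^ d) * b) :
    (δ * ((1 - δ * ε ^ d) / (1 + γ * ε ^ (d - 1)))) ^ (d + 1) ≤ b ^ (d + 1) ∧
      b ^ (d + 1) ≤ (δ * ((1 + δ * ε ^ d) / (1 - γ * ε ^ (d - 1)))) ^ (d + 1) := by
  have h1 : 0 ≤ γ * ε ^ (d - 1) := by positivity
  have h2 : 0 ≤ δ * ε ^ d := by positivity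
  constructor
  · refine pow_le_pow_left₀ ?_ ?_ _
    · exact mul_nonneg hδ (div_nonneg (by linarith) (by linarith))
    · rw [← mul_div_assoc, div_le_iff₀ (by linarith)]
      have h3 : δ * (1 - δ * ε ^ d) ≤ (1 + δ * ε ^ d) * b * (1 - δ * ε ^ d) :=
        mul_le_mul_of_nonneg_right hlow (by linarith)
      nlinarith [mul_nonneg hb (mul_nonneg h2 h2), mul_nonneg hb h1]
  · refine pow_le_pow_left₀ hb ?_ _
    rw [← mul_div_assoc, le_div_iff₀ (by linarith)]
    have h3 : b ^ d ≤ ε ^ (d - 1) * b := by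
      obtain ⟨n, rfl⟩ : ∃ n, d = n + 1 := ⟨d - 1, by omega⟩
      rw [pow_succ, Nat.add_sub_cancel]
      gcongr
    nlinarith [mul_le_mul_of_nonneg_left h3 hγ, mul_nonneg hδ h2]

end

end TreeGibbs

end

theorem theorem2p2 {V : Type*} (k d : ℕ) (hk : 1 ≤ k) (hd : 2 ≤ d)
    (G : SimpleGraph V) [G.LocallyFinite] (hTree : G.IsTree) (hReg : G.IsRegularOfDegree (d + 1))
    (Q : TreeGibbs.TransferOperator k) (hQ0 : Q 0 = 1) (γ δ : ℝ)
    (hγ : TreeGibbs.pNorm (((d : ℝ) + 1) / 2) Set.univ Q = ENNReal.ofReal γ)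
    (hδ : TreeGibbs.pNorm ((d : ℝ) + 1) {0}ᶜ Q = ENNReal.ofReal δ)
    (hGood : (γ, δ) ∈ TreeGibbs.goodSet d) :
    ∃ μ : TreeGibbs.Lattice k → Measure (TreeGibbs.Config V k),
      (∀ i, TreeGibbs.IsGibbsMeasure G Q (μ i)) ∧
      (∀ i, TreeGibbs.IsAutInvariant G (μ i)) ∧
      Function.Injective μ ∧
      (∀ i j, (μ i).map (fun ω x => ω x + j) = μ (i + j)) ∧
      ∃ ε : ℝ, IsLeast {t : ℝ | 0 < t ∧ t = γ * t ^ d + δ} ε ∧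
        0 < 1 - γ * ε ^ (d - 1) ∧
        ∀ (i : TreeGibbs.Lattice k) (x : V),
          0 < (μ i).real {ω | ω x = i} ∧
          (δ * ((1 - δ * ε ^ d) / (1 + γ * ε ^ (d - 1)))) ^ (d + 1) ≤
            (μ i).real {ω | ω x ≠ i} / (μ i).real {ω | ω x = i} ∧
          (μ i).real {ω | ω x ≠ i} / (μ i).real {ω | ω x = i} ≤
            (δ * ((1 + δ * ε ^ d) / (1 - γ * ε ^ (d - 1)))) ^ (d + 1) := by
  open TreeGibbs in
  have hγ1 : 1 < γ := hGood.1
  have hδ0 : 0 < δ := hGood.2.1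
  have hnorms := hasNorms_of_pNorm (by omega) hQ0 (by linarith) hδ0.le hγ hδ
  obtain ⟨ε, hε, hsmall⟩ := exists_isLeast_of_mem_goodSet hd hGood
  have hε0 : 0 < ε := hε.1.1
  have hεeq : ε = γ * ε ^ d + δ := hε.1.2
  have hd2 : (2 : ℝ) ≤ d := by exact_mod_cast hd
  have hA : 0 ≤ γ * ε ^ (d - 1) := by positivity
  have hB : 0 ≤ δ * ε ^ d := by positivity
  have hA' : d * γ * ε ^ (d - 1) < 1 / 2 := by nlinarith
  have hA1 : γ * ε ^ (d - 1) < 1 := by nlinarith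
  have hB1 : δ * ε ^ d ≤ 1 := by nlinarith
  have hε1 : ε < 1 := by
    by_contra! hge
    have : (1 : ℝ) ≤ ε ^ (d - 1) := one_le_pow₀ hge
    nlinarith
  have hc : d * γ * ε ^ (d - 1) * (1 + ε) < 1 := by nlinarith
  obtain ⟨y, hy, hfix⟩ := hnorms.exists_fixedPoint hε0.le (by linarith) hc
  have hlaw := hnorms.isBoundaryLaw hε0.le hy hfix
  set S := ∑' j, y j ^ (d + 1) with hS
  have hS0 : 0 ≤ S := tsum_nonneg fun j => pow_nonneg (hy.nonneg j) _
  choose μ hprob hμ using fun i => (hlaw.translate i).exists_measure hTree hReg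
  have hmarg : ∀ i (v : V) j, (μ i).real {ω | ω v = j} =
      lawOfFixedPoint y (j - i) ^ (d + 1) / (1 + S) := fun i v j =>
    (hμ i).measureReal_singleton hReg (hlaw.translate i) v j
  have hself : ∀ i (v : V), (μ i).real {ω | ω v = i} = 1 / (1 + S) := by
    intro i v
    rw [hmarg, sub_self, lawOfFixedPoint, if_pos rfl, one_pow]
  refine ⟨μ, fun i => (hμ i).isGibbsMeasure hTree.connected (hlaw.translate i),
    fun i => (hμ i).isAutInvariant hTree.connected, ?_, ?_, ε, hε, by linarith, ?_⟩
  · intro i j hij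
    by_contra hne
    obtain ⟨v⟩ := hTree.connected.nonempty
    have h1 := hself i v
    rw [hij, hmarg j v i, lawOfFixedPoint, if_neg (sub_ne_zero.2 hne),
      div_left_inj' (by linarith : 1 + S ≠ 0)] at h1
    have h2 : y (i - j) ^ (d + 1) < 1 :=
      pow_lt_one₀ (hy.nonneg _) ((hy.le hε0.le _).trans_lt hε1) (Nat.succ_ne_zero d)
    exact h2.ne h1
  · intro i j
    refine HasMessageMarginals.unique hTree.connected ?_ (hμ (i + j))
    have h1 := (hμ i).translate j
    simpa only [sub_sub, add_comm j i] using h1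
  · intro i v
    have hpos : 0 < (μ i).real {ω | ω v = i} := by
      rw [hself]
      positivity
    have hratio : (μ i).real {ω | ω v ≠ i} / (μ i).real {ω | ω v = i} = S := by
      have hm : MeasurableSet {ω : Config V k | ω v = i} :=
        (measurable_pi_apply v : Measurable fun ω : Config V k => ω v) (measurableSet_singleton i)
      have h1 : (μ i).real {ω | ω v ≠ i} = 1 - (μ i).real {ω | ω v = i} :=
        probReal_compl_eq_one_sub hm
      rw [h1, hself]
      field_simp
      ring
    refine ⟨hpos, ?_⟩
    rw [hratio]
    have hroot : S = (S ^ (((d + 1 : ℕ) : ℝ)⁻¹)) ^ (d + 1) :=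
      (Real.rpow_inv_natCast_pow hS0 (Nat.succ_ne_zero d)).symm
    have hb0 : 0 ≤ S ^ (((d + 1 : ℕ) : ℝ)⁻¹) := Real.rpow_nonneg hS0 _
    obtain ⟨h1, h2, h3⟩ := hnorms.norm_bounds hε0.le hy hfix hb0 (hS ▸ hroot)
    rw [hroot]
    exact localization_bounds (by omega) (by linarith) hδ0.le hε0.le hA1 hB1 hb0 h1 h2 h3
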